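/- Let $\Gamma$ be a discrete group with left regular representation $\lambda$ on $\ell^2(\Gamma)$, let $C^*_r(\Gamma)\subseteq B(\ell^2(\Gamma))$ be its reduced group $C^*$-algebra (the norm closed $*$-algebra generated by $\lambda(\Gamma)$), and let $\mathfrak M(\Gamma)=\lambda(\Gamma)''$ be its group von Neumann algebra, with predual $\mathfrak M(\Gamma)_*$. Let $A(\Gamma)$ be the Fourier algebra, that is, the set of matrix coefficients $x\mapsto\langle\lambda(x)f,g\rangle$ with $f,g\in\ell^2(\Gamma)$; it is identified with $\mathfrak M(\Gamma)_*$ by letting $a\in\mathfrak M(\Gamma)$ act on this coefficient as $\langle af,g\rangle$, and $\|\cdot\|_{A(\Gamma)}$ is the norm of functionals, $$\|u\|_{A(\Gamma)}=\sup\Big\{\Big|\sum_x c(x)u(x)\Big| : c\colon\Gamma\to\mathbb C \text{ finitely supported},\ \Big\|\sum_x c(x)\lambda(x)\Big\|\le 1\Big\}.$$ For a function $\phi$ on $\Gamma$ such that $\phi\psi\in A(\Gamma)$ for all $\psi\in A(\Gamma)$, let $m_\phi\colon A(\Gamma)\to A(\Gamma)$, $m_\phi\psi=\phi\psi$, and let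 $\|\phi\|_{M_0A(\Gamma)}=\|m_\phi^*\|_{CB}\in[0,\infty]$ be the completely bounded norm of the transposed operator $m_\phi^*$ on $\mathfrak M(\Gamma)$; for every other function $\phi$ put $\|\phi\|_{M_0A(\Gamma)}=\infty$. Let $1\le k<\infty$. Then the following three conditions are equivalent. 1. $A(\Gamma)$ has an approximate unit $(\phi_\alpha)$ such that $\|\phi_\alpha\|_{M_0A(\Gamma)}\le k$ for all $\alpha$; here an approximate unit is a net $(\phi_\alpha)$ in $A(\Gamma)$ with $\lim_\alpha\|\phi_\alpha\psi-\psi\|_{A(\Gamma)}=0$ for all $\psi\in A(\Gamma)$. 2. There exists a net $(T_\alpha)$ of finite rank bounded linear operators on $C^*_r(\Gamma)$ such that $\|T_\alpha\|_{CB}\le k$ for all $\alpha$ and $\|T_\alpha x-x\|\to 0$ for all $x\in C^*_r(\Gamma)$. 3. There exists a net $(T_\alpha)$ of $\sigma$-weakly continuous finite rank bounded linear operators on $\mathfrak M(\Gamma)$ such that $\|T_\alpha\|_{CB}\le k$ for all $\alpha$ and $\langle\omega,T_\alpha x-x\rangle\to 0$ for all $x\in\mathfrak M(\Gamma)$ and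 $\omega\in\mathfrak M(\Gamma)_*$. -/

import Mathlib

universe u

open scoped ENNReal InnerProductSpace Topology

noncomputable section

namespace GroupCBAP

/-! ### Completely bounded maps between matrix amplifications of operator algebras -/

section Operators

variable {H : Type*} [NormedAddCommGroup H] [InnerProductSpace ℂ H]

/-- The operator on the Hilbert space direct sum `H ⊕ ⋯ ⊕ H` (`n` copies) given by an
`n × n` matrix of bounded operators on `H`. -/
def matrixOp {n : ℕ} (a : Matrix (Fin n) (Fin n) (H →L[ℂ] H)) :
    PiLp 2 (fun _ : Fin n => H) →L[ℂ] PiLp 2 (fun _ : Fin n => H) :=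
  ((PiLp.continuousLinearEquiv 2 ℂ (fun _ : Fin n => H)).symm :
      (Fin n → H) →L[ℂ] PiLp 2 (fun _ : Fin n => H)).comp
    (ContinuousLinearMap.pi fun i => ∑ j, (a i j).comp (PiLp.proj 2 (fun _ : Fin n => H) j))

theorem matrixOp_apply {n : ℕ} (a : Matrix (Fin n) (Fin n) (H →L[ℂ] H))
    (v : PiLp 2 (fun _ : Fin n => H)) (i : Fin n) :
    matrixOp a v i = ∑ j, a i j (v j) := by
  simp [matrixOp]

variable [CompleteSpace H]

/-- The completely bounded norm `‖T‖_CB = sup_n ‖T ⊗ id_n‖` (possibly `∞`) of a map on an operator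
algebra `A ⊆ B(H)`, where `M_n(A)` has the norm it inherits from `M_n(B(H)) = B(Hⁿ)`. -/
def cbNorm {A : StarSubalgebra ℂ (H →L[ℂ] H)} (T : A →L[ℂ] A) : ℝ≥0∞ :=
  ⨆ (n : ℕ) (a : Matrix (Fin n) (Fin n) A)
    (_ : ‖matrixOp (a.map fun x => (x : H →L[ℂ] H))‖ ≤ 1),
    ‖matrixOp (a.map fun x => (T x : H →L[ℂ] H))‖ₑ

/-- `T` has finite rank. -/
def IsFiniteRank {A : StarSubalgebra ℂ (H →L[ℂ] H)} (T : A →L[ℂ] A) : Prop :=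
  FiniteDimensional ℂ (LinearMap.range (T : A →ₗ[ℂ] A))

/-- The predual `M_*` of a von Neumann algebra `M ⊆ B(H)`, as a set of functionals on `M`: those of
the form `a ↦ ∑ₙ ⟨a ξₙ, ηₙ⟩` with `∑ₙ ‖ξₙ‖² < ∞` and `∑ₙ ‖ηₙ‖² < ∞`. -/
def predual (M : VonNeumannAlgebra H) : Set (M.toStarSubalgebra →L[ℂ] ℂ) :=
  {ω | ∃ ξ η : ℕ → H, Summable (fun n => ‖ξ n‖ ^ 2) ∧ Summable (fun n => ‖η n‖ ^ 2) ∧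
    ∀ a, ω a = ∑' n, ⟪η n, (a : H →L[ℂ] H) (ξ n)⟫_ℂ}

/-- The σ-weak topology `σ(M, M_*)` on a von Neumann algebra. -/
@[reducible] def sigmaWeak (M : VonNeumannAlgebra H) : TopologicalSpace M.toStarSubalgebra :=
  ⨅ ω ∈ predual M, TopologicalSpace.induced ω inferInstance

/-- `T` is continuous for the σ-weak topology on both sides. -/
def IsSigmaWeaklyContinuous {M : VonNeumannAlgebra H}
    (T : M.toStarSubalgebra →L[ℂ] M.toStarSubalgebra) : Prop :=
  Continuous[sigmaWeak M, sigmaWeak M] T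

end Operators

/-! ### The regular representation and its operator algebras -/

section Group

/-- The Hilbert space `ℓ²(Γ)`. -/
abbrev ell2 (Γ : Type*) : Type _ := lp (fun _ : Γ => ℂ) 2

variable {Γ : Type*} [Group Γ]

theorem memℓp_translate (x : Γ) (f : ell2 Γ) :
    Memℓp (fun y => f (x⁻¹ * y) : Γ → ℂ) 2 := by
  have h := lp.memℓp f
  rw [memℓp_gen_iff (by norm_num)] at h ⊢
  exact h.comp_injective (mul_right_injective x⁻¹)

/-- The left regular representation: `(λ(x) f)(y) = f(x⁻¹ y)`. -/
def leftReg (x : Γ) : ell2 Γ →L[ℂ] ell2 Γ :=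
  LinearIsometry.toContinuousLinearMap
    { toFun := fun f => ⟨fun y => f (x⁻¹ * y), memℓp_translate x f⟩
      map_add' := fun _ _ => rfl
      map_smul' := fun _ _ => rfl
      norm_map' := fun f => by
        have h2 : 0 < (2 : ℝ≥0∞).toReal := by norm_num
        rw [lp.norm_eq_tsum_rpow h2, lp.norm_eq_tsum_rpow h2]
        congr 1
        exact (Equiv.mulLeft x⁻¹).tsum_eq (fun y => ‖f y‖ ^ (2 : ℝ≥0∞).toReal) }

theorem leftReg_apply (x : Γ) (f : ell2 Γ) (y : Γ) : leftReg x f y = f (x⁻¹ * y) := rfl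

variable (Γ)

/-- The reduced group C*-algebra: the norm closed *-algebra generated by `λ(Γ)`. -/
def reducedCStar : StarSubalgebra ℂ (ell2 Γ →L[ℂ] ell2 Γ) :=
  (StarAlgebra.adjoin ℂ (Set.range (leftReg (Γ := Γ)))).topologicalClosure

/-- The group von Neumann algebra: the bicommutant of `λ(Γ)`. -/
def groupVN : VonNeumannAlgebra (ell2 Γ) where
  toStarSubalgebra := StarSubalgebra.centralizer ℂ
    (StarSubalgebra.centralizer ℂ (Set.range (leftReg (Γ := Γ))) : Set (ell2 Γ →L[ℂ] ell2 Γ))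
  centralizer_centralizer' := by
    change Set.centralizer (Set.centralizer (StarSubalgebra.centralizer ℂ
      (StarSubalgebra.centralizer ℂ (Set.range (leftReg (Γ := Γ))) :
        Set (ell2 Γ →L[ℂ] ell2 Γ)) : Set (ell2 Γ →L[ℂ] ell2 Γ))) = _
    rw [StarSubalgebra.coe_centralizer, Set.centralizer_centralizer_centralizer]
    rfl

variable {Γ}

/-! ### The Fourier algebra and its completely bounded multipliers -/

/-- The matrix coefficient `x ↦ ⟨λ(x) f, g⟩` of the left regular representation. -/
def coeff (f g : ell2 Γ) (x : Γ) : ℂ := ⟪g, leftReg x f⟫_ℂ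

variable (Γ) in
/-- The Fourier algebra `A(Γ)`: all matrix coefficients of the left regular representation. -/
def fourierAlgebra : Set (Γ → ℂ) := {u | ∃ f g : ell2 Γ, u = coeff f g}

/-- The norm of `A(Γ)`: the norm of `u` as the functional `∑ c(x) λ(x) ↦ ∑ c(x) u(x)` on the group
algebra, normed by its regular representation. The formula makes sense, with values in `[0, ∞]`,
for every function `u`; on `A(Γ)` it is the norm of `u` as an element of the predual
of the group von Neumann algebra. -/
def fourierNorm (u : Γ → ℂ) : ℝ≥0∞ :=
  ⨆ (c : Γ →₀ ℂ) (_ : ‖c.sum fun x z => z • leftReg x‖ ≤ 1), ‖c.sum fun x z => z * u x‖ₑ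

/-- `φ` is a multiplier of `A(Γ)`. -/
def IsMultiplier (φ : Γ → ℂ) : Prop :=
  ∀ ψ ∈ fourierAlgebra Γ, φ * ψ ∈ fourierAlgebra Γ

/-- `S` is the transpose `m_φ^*`, on the dual of `A(Γ)`, of the multiplication `m_φ : ψ ↦ φ ψ`.
The dual of `A(Γ)` is the group von Neumann algebra, where `a` acts on the
coefficient `x ↦ ⟨λ(x) f, g⟩` by `⟨a f, g⟩`; so the condition is `⟨S a, ψ⟩ = ⟨a, φ ψ⟩`. -/
def IsTransposedMultiplication (φ : Γ → ℂ)
    (S : (groupVN Γ).toStarSubalgebra →L[ℂ] (groupVN Γ).toStarSubalgebra) : Prop :=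
  ∀ f g f' g' : ell2 Γ, φ * coeff f g = coeff f' g' → ∀ a : (groupVN Γ).toStarSubalgebra,
    ⟪g, (S a : ell2 Γ →L[ℂ] ell2 Γ) f⟫_ℂ = ⟪g', (a : ell2 Γ →L[ℂ] ell2 Γ) f'⟫_ℂ

/-- The completely bounded multiplier norm `‖φ‖_{M₀A} = ‖m_φ^*‖_CB`; it is `∞` if `φ` is not a
completely bounded multiplier. (The infimum is over the at most one operator `m_φ^*`.) -/
def multiplierCBNorm (φ : Γ → ℂ) : ℝ≥0∞ :=
  ⨅ (S : (groupVN Γ).toStarSubalgebra →L[ℂ] (groupVN Γ).toStarSubalgebra)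
    (_ : IsMultiplier φ ∧ IsTransposedMultiplication φ S), cbNorm S

end Group

end GroupCBAP

end

/-!
Each of the three conditions says that the constant function `1` is a pointwise limit of finitely
supported functions whose Herz–Schur norm, the supremum over finite tuples `p` of the norms of the
Schur multipliers `[φ (p i * (p j)⁻¹)]`, is at most `k`.

A completely bounded map `T` on an algebra between `C*_r(Γ)` and `𝔐(Γ)` has the symbol
`x ↦ ⟨T(λ(x)) δ₁, δₓ⟩`, of Herz–Schur norm at most `‖T‖_CB`: the operator matrix
`[m i j • λ(p i * (p j)⁻¹)]` is `[m i j]` conjugated by the unitaries `λ(p i)`. When `T` has finite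
rank the symbol lies in `ℓ²(Γ) ⊆ A(Γ)`. Conversely, `φ ∈ ℓ²(Γ)` acts on both algebras by
`a ↦ ∑ₓ φ(x) ⟨a δ₁, δₓ⟩ λ(x)`, whose matrix entries are those of `a` multiplied by
`φ (z * y⁻¹)`, so its completely bounded norm is at most the Herz–Schur norm of `φ`. Elements of
`A(Γ)` are approximated in the norm of `A(Γ)`, which dominates the Herz–Schur norm, by finitely
supported ones; the small excess in the bound is removed by rescaling.
-/

noncomputable section

namespace GroupCBAP

open Filter ComplexConjugate
open scoped Matrix.Norms.L2Operator

theorem enorm_le_mul_enorm_of_homogeneous {V E F : Type*} [SMul ℂ V]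
    [NormedAddCommGroup E] [NormedSpace ℂ E] [NormedAddCommGroup F] [NormedSpace ℂ F]
    {f : V → F} {g : V → E} (hf : ∀ (c : ℂ) v, f (c • v) = c • f v)
    (hg : ∀ (c : ℂ) v, g (c • v) = c • g v) (hfg : ∀ v, g v = 0 → f v = 0) {S : ℝ≥0∞}
    (hS : ∀ v, ‖g v‖ ≤ 1 → ‖f v‖ₑ ≤ S) (v : V) : ‖f v‖ₑ ≤ S * ‖g v‖ₑ := by
  rcases eq_or_ne (g v) 0 with h0 | h0
  · simp [hfg v h0]
  have hpos : ‖g v‖ₑ ≠ 0 := enorm_ne_zero.2 h0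
  have hunit := hS ((‖g v‖⁻¹ : ℂ) • v) (by simp [hg, norm_smul, h0])
  have hscale : ‖(‖g v‖ : ℂ)⁻¹‖ₑ = ‖g v‖ₑ⁻¹ := by
    rw [enorm_inv (by simpa using h0), ← ofReal_norm, Complex.norm_real, norm_norm, ofReal_norm]
  rw [hf, enorm_smul, hscale] at hunit
  rwa [← ENNReal.div_le_iff hpos enorm_ne_top, ENNReal.div_eq_inv_mul]

section Compression

variable {K : Type*} [NormedAddCommGroup K] [InnerProductSpace ℂ K]
variable {ι : Type*} [Fintype ι]

theorem opNorm_le_of_norm_inner_le {E : Type*} [NormedAddCommGroup E] [InnerProductSpace ℂ E]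
    {T : E →L[ℂ] K} {C : ℝ} (hC : 0 ≤ C) (h : ∀ v w, ‖⟪w, T v⟫_ℂ‖ ≤ C * ‖v‖ * ‖w‖) : ‖T‖ ≤ C :=
  ContinuousLinearMap.opNorm_le_of_re_inner_le hC fun v w hv hw => by
    simpa [hv, hw, norm_inner_symm w] using (RCLike.re_le_norm ⟪T v, w⟫_ℂ).trans
      ((norm_inner_symm _ _).trans_le (h v w))

theorem norm_sum_smul_of_orthonormal {e : ι → K} (he : Orthonormal ℂ e) (x : EuclideanSpace ℂ ι) :
    ‖∑ s, x s • e s‖ = ‖x‖ := by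
  rw [← sq_eq_sq₀ (norm_nonneg _) (norm_nonneg _), @norm_sq_eq_re_inner ℂ, he.inner_sum,
    EuclideanSpace.norm_sq_eq]
  simp [Complex.conj_mul', ← Complex.ofReal_pow]

/-- The matrix of the compression of `B` to the span of an orthonormal family `e`. -/
def compression (B : K →L[ℂ] K) (e : ι → K) : Matrix ι ι ℂ :=
  Matrix.of fun s t => ⟪e s, B (e t)⟫_ℂ

variable [DecidableEq ι]

theorem inner_toEuclideanCLM_compression (B : K →L[ℂ] K) (e : ι → K) (x y : EuclideanSpace ℂ ι) :
    ⟪x, Matrix.toEuclideanCLM (𝕜 := ℂ) (compression B e) y⟫_ℂ =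
      ⟪∑ s, x s • e s, B (∑ t, y t • e t)⟫_ℂ := by
  simp only [PiLp.inner_apply, RCLike.inner_apply, Matrix.ofLp_toEuclideanCLM, Matrix.mulVec,
    dotProduct, compression, Matrix.of_apply, map_sum, map_smul, sum_inner, inner_sum,
    inner_smul_left, inner_smul_right, Finset.mul_sum, Finset.sum_mul]
  rw [Finset.sum_comm]
  exact Finset.sum_congr rfl fun s _ => Finset.sum_congr rfl fun t _ => by ring

theorem norm_compression_le (B : K →L[ℂ] K) {e : ι → K} (he : Orthonormal ℂ e) :
    ‖compression B e‖ ≤ ‖B‖ := by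
  refine opNorm_le_of_norm_inner_le (norm_nonneg B) fun y x => ?_
  change ‖⟪x, Matrix.toEuclideanCLM (𝕜 := ℂ) (compression B e) y⟫_ℂ‖ ≤ _
  rw [inner_toEuclideanCLM_compression, ← norm_sum_smul_of_orthonormal he x,
    ← norm_sum_smul_of_orthonormal he y, mul_comm]
  exact (norm_inner_le_norm _ _).trans (by gcongr; exact B.le_opNorm _)

theorem norm_inner_sum_smul_le (B : K →L[ℂ] K) {e : ι → K} (he : Orthonormal ℂ e) (x y : ι → ℂ) :
    ‖⟪∑ s, x s • e s, B (∑ t, y t • e t)⟫_ℂ‖ ≤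
      ‖compression B e‖ * ‖∑ t, y t • e t‖ * ‖∑ s, x s • e s‖ := by
  have h := inner_toEuclideanCLM_compression B e (WithLp.toLp 2 x) (WithLp.toLp 2 y)
  rw [← h, norm_sum_smul_of_orthonormal he (WithLp.toLp 2 x),
    norm_sum_smul_of_orthonormal he (WithLp.toLp 2 y), mul_comm]
  exact (norm_inner_le_norm _ _).trans (by gcongr; exact ContinuousLinearMap.le_opNorm _ _)

theorem enorm_le_of_enorm_compression_le {X : Type*} (b : HilbertBasis X ℂ K) (B : K →L[ℂ] K)
    {C : ℝ≥0∞} (h : ∀ (n : ℕ) (p : Fin n ↪ X), ‖compression B (b ∘ p)‖ₑ ≤ C) : ‖B‖ₑ ≤ C := by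
  rcases eq_or_ne C ∞ with rfl | hC
  · exact le_top
  have h' (n : ℕ) (p : Fin n ↪ X) : ‖compression B (b ∘ p)‖ ≤ C.toReal := by
    simpa using ENNReal.toReal_mono hC (h n p)
  rw [← ofReal_norm, ENNReal.ofReal_le_iff_le_toReal hC]
  refine opNorm_le_of_norm_inner_le ENNReal.toReal_nonneg fun v w => ?_
  have hv := b.hasSum_repr v
  have hw := b.hasSum_repr w
  have hBv : Tendsto (fun F : Finset X => B (∑ x ∈ F, b.repr v x • b x)) atTop (𝓝 (B v)) :=
    (B.continuous.tendsto v).comp hv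
  refine le_of_tendsto_of_tendsto' (hw.inner hBv).norm ((hv.norm.const_mul _).mul hw.norm)
    fun F => ?_
  let p : Fin F.card ↪ X := F.equivFin.symm.toEmbedding.trans (.subtype _)
  have hsum (u : K) : ∑ x ∈ F, b.repr u x • b x = ∑ s, b.repr u (p s) • (b ∘ p) s := by
    rw [← F.sum_coe_sort, ← F.equivFin.symm.sum_comp]
    rfl
  rw [hsum, hsum]
  exact (norm_inner_sum_smul_le B (b.orthonormal.comp p p.injective) _ _).trans
    (by gcongr; exact h' _ p)

end Compression

section Amplification

variable {H : Type*} [NormedAddCommGroup H] [InnerProductSpace ℂ H] {n : ℕ}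

theorem matrixOp_single (a : Matrix (Fin n) (Fin n) (H →L[ℂ] H)) (i j : Fin n) (v : H) :
    matrixOp a (PiLp.single 2 j v) i = a i j v := by
  rw [matrixOp_apply, Finset.sum_eq_single j (fun l _ hl => by simp [hl]) (by simp)]
  simp

theorem norm_entry_le_norm_matrixOp (a : Matrix (Fin n) (Fin n) (H →L[ℂ] H)) (i j : Fin n) :
    ‖a i j‖ ≤ ‖matrixOp a‖ := by
  refine ContinuousLinearMap.opNorm_le_bound _ (norm_nonneg (matrixOp a)) fun v => ?_
  calc ‖a i j v‖ = ‖matrixOp a (PiLp.single 2 j v) i‖ := by rw [matrixOp_single]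
    _ ≤ ‖matrixOp a (PiLp.single 2 j v)‖ := PiLp.norm_apply_le _ i
    _ ≤ ‖matrixOp a‖ * ‖PiLp.single (β := fun _ : Fin n => H) 2 j v‖ := (matrixOp a).le_opNorm _
    _ = ‖matrixOp a‖ * ‖v‖ := by rw [PiLp.norm_single]

theorem matrixOp_smul (c : ℂ) (a : Matrix (Fin n) (Fin n) (H →L[ℂ] H)) :
    matrixOp (c • a) = c • matrixOp a := by
  ext v i
  simp [matrixOp_apply, Finset.smul_sum]

theorem inner_single_left (i : Fin n) (v : H) (w : PiLp 2 fun _ : Fin n => H) :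
    ⟪PiLp.single 2 i v, w⟫_ℂ = ⟪v, w i⟫_ℂ := by
  rw [PiLp.inner_apply, Finset.sum_eq_single i (fun l _ hl => by simp [hl]) (by simp)]
  simp

/-- The Hilbert basis of `H ⊕ ⋯ ⊕ H` consisting of copies of a Hilbert basis of `H` in each
summand. -/
def amplifiedBasis [CompleteSpace H] {X : Type*} (b : HilbertBasis X ℂ H) (n : ℕ) :
    HilbertBasis (Fin n × X) ℂ (PiLp 2 fun _ : Fin n => H) :=
  HilbertBasis.mkOfOrthogonalEqBot (v := fun q => PiLp.single 2 q.1 (b q.2)) (by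
    classical
    rw [orthonormal_iff_ite]
    rintro ⟨i, x⟩ ⟨j, y⟩
    rw [inner_single_left]
    by_cases h : i = j
    · subst h
      simp [orthonormal_iff_ite.1 b.orthonormal]
    · simp [h]) (by
    refine (Submodule.eq_bot_iff _).2 fun w hw => ?_
    ext1 i
    refine b.repr.injective (lp.ext (funext fun x => ?_))
    have hx := hw _ (Submodule.subset_span ⟨(i, x), rfl⟩)
    simpa [inner_single_left, b.repr_apply_apply] using hx)

theorem amplifiedBasis_apply [CompleteSpace H] {X : Type*} (b : HilbertBasis X ℂ H)
    (q : Fin n × X) : amplifiedBasis b n q = PiLp.single 2 q.1 (b q.2) := by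
  rw [amplifiedBasis, HilbertBasis.coe_mkOfOrthogonalEqBot]

variable [CompleteSpace H] {A : StarSubalgebra ℂ (H →L[ℂ] H)}

theorem enorm_matrixOp_map_le (T : A →L[ℂ] A) (a : Matrix (Fin n) (Fin n) A) :
    ‖matrixOp (a.map fun x => (T x : H →L[ℂ] H))‖ₑ ≤
      cbNorm T * ‖matrixOp (a.map fun x => (x : H →L[ℂ] H))‖ₑ := by
  refine enorm_le_mul_enorm_of_homogeneous
    (f := fun a : Matrix (Fin n) (Fin n) A => matrixOp (a.map fun x => (T x : H →L[ℂ] H)))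
    (g := fun a => matrixOp (a.map fun x => (x : H →L[ℂ] H)))
    (fun c a => ?_) (fun c a => ?_) (fun a ha => ?_) (fun a ha => ?_) a
  · rw [← matrixOp_smul]
    congr 1
    ext1 i j
    simp
  · rw [← matrixOp_smul]
    rfl
  · have h0 : a = 0 := by
      ext1 i j
      have hentry := norm_entry_le_norm_matrixOp (a.map fun x => (x : H →L[ℂ] H)) i j
      rw [ha, norm_zero, norm_le_zero_iff] at hentry
      exact Subtype.ext hentry
    ext v i
    simp [h0, matrixOp_apply]
  · exact le_iSup_of_le n (le_iSup₂_of_le a ha le_rfl)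

end Amplification

section Delta

variable {Γ : Type*}

/-- The standard Hilbert basis of `ℓ²(Γ)`. -/
def delta : HilbertBasis Γ ℂ (ell2 Γ) := default

theorem inner_delta_left (x : Γ) (f : ell2 Γ) : ⟪delta x, f⟫_ℂ = f x :=
  (delta.repr_apply_apply f x).symm

open Classical in
theorem delta_apply (x y : Γ) : delta x y = if y = x then 1 else 0 := by
  rw [← inner_delta_left, orthonormal_iff_ite.1 delta.orthonormal]

theorem norm_delta (x : Γ) : ‖delta x‖ = 1 := delta.orthonormal.1 x

theorem hasSum_delta (f : ell2 Γ) : HasSum (fun x => f x • delta x) f := delta.hasSum_repr f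

end Delta

section RegularRepresentation

variable {Γ : Type*}

theorem hasSum_norm_sq (f : ell2 Γ) : HasSum (fun x => ‖f x‖ ^ 2) (‖f‖ ^ 2) := by
  simpa using lp.hasSum_norm (p := 2) (by simp) f

theorem memℓp_two_iff {u : Γ → ℂ} : Memℓp u 2 ↔ Summable fun x => ‖u x‖ ^ 2 := by
  simp [memℓp_gen_iff]

variable [Group Γ]

theorem leftReg_delta (x y : Γ) : leftReg x (delta y) = delta (x * y) := by
  refine lp.ext (funext fun z => ?_)
  rw [leftReg_apply, delta_apply, delta_apply]
  classical exact if_congr inv_mul_eq_iff_eq_mul rfl rfl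

theorem norm_leftReg_apply (x : Γ) (f : ell2 Γ) : ‖leftReg x f‖ = ‖f‖ := by
  rw [leftReg, LinearIsometry.coe_toContinuousLinearMap, LinearIsometry.norm_map]

theorem norm_leftReg_le (x : Γ) : ‖leftReg x‖ ≤ 1 :=
  ContinuousLinearMap.opNorm_le_bound _ zero_le_one fun f => by simp [norm_leftReg_apply]

theorem leftReg_mul (x y : Γ) : leftReg (x * y) = leftReg x * leftReg y := by
  ext f z
  simp [leftReg_apply, mul_assoc]

theorem leftReg_one : leftReg (1 : Γ) = 1 := by
  ext f z
  simp [leftReg_apply]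

theorem star_leftReg (x : Γ) : star (leftReg x) = leftReg x⁻¹ := by
  rw [ContinuousLinearMap.star_eq_adjoint, eq_comm, ContinuousLinearMap.eq_adjoint_iff]
  intro f g
  rw [lp.inner_eq_tsum, lp.inner_eq_tsum, ← (Equiv.mulLeft x⁻¹).tsum_eq]
  simp [leftReg_apply]

theorem mem_groupVN_iff {a : ell2 Γ →L[ℂ] ell2 Γ} :
    a ∈ (groupVN Γ).toStarSubalgebra ↔
      ∀ b : ell2 Γ →L[ℂ] ell2 Γ, (∀ x, leftReg x * b = b * leftReg x) → b * a = a * b := by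
  have key (b : ell2 Γ →L[ℂ] ell2 Γ) :
      b ∈ (StarSubalgebra.centralizer ℂ (Set.range (leftReg (Γ := Γ))) :
        Set (ell2 Γ →L[ℂ] ell2 Γ)) ↔ ∀ x, leftReg x * b = b * leftReg x := by
    rw [SetLike.mem_coe, StarSubalgebra.mem_centralizer_iff, Set.forall_mem_range]
    simp only [star_leftReg]
    exact ⟨fun h x => (h x).1, fun h x => ⟨h x, h x⁻¹⟩⟩
  change a ∈ StarSubalgebra.centralizer ℂ _ ↔ _
  rw [StarSubalgebra.mem_centralizer_iff]
  exact ⟨fun h b hb => (h b ((key b).2 hb)).1, fun h b hb => ⟨h b ((key b).1 hb),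
    h _ ((key _).1 (star_mem (S := StarSubalgebra ℂ (ell2 Γ →L[ℂ] ell2 Γ)) hb))⟩⟩

theorem isClosed_groupVN :
    IsClosed ((groupVN Γ).toStarSubalgebra : Set (ell2 Γ →L[ℂ] ell2 Γ)) := by
  have hcoe : ((groupVN Γ).toStarSubalgebra : Set (ell2 Γ →L[ℂ] ell2 Γ)) =
      ⋂ (b : ell2 Γ →L[ℂ] ell2 Γ) (_ : ∀ x, leftReg x * b = b * leftReg x),
        {a | b * a = a * b} := by
    ext a
    simp only [SetLike.mem_coe, mem_groupVN_iff, Set.mem_iInter, Set.mem_ofPred_eq]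
  rw [hcoe]
  exact isClosed_iInter fun b => isClosed_iInter fun _ =>
    isClosed_eq (by fun_prop) (by fun_prop)

theorem memℓp_translate_right (x : Γ) (f : ell2 Γ) : Memℓp (fun y => f (y * x) : Γ → ℂ) 2 :=
  memℓp_two_iff.2 ((hasSum_norm_sq f).summable.comp_injective (mul_left_injective x))

/-- The right regular representation: `(ρ(x) f)(y) = f(y x)`. -/
def rightReg (x : Γ) : ell2 Γ →L[ℂ] ell2 Γ :=
  LinearIsometry.toContinuousLinearMap
    { toFun := fun f => ⟨fun y => f (y * x), memℓp_translate_right x f⟩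
      map_add' := fun _ _ => rfl
      map_smul' := fun _ _ => rfl
      norm_map' := fun f => by
        rw [← sq_eq_sq₀ (norm_nonneg _) (norm_nonneg _), ← (hasSum_norm_sq f).tsum_eq,
          ← (hasSum_norm_sq _).tsum_eq]
        exact (Equiv.mulRight x).tsum_eq fun y => ‖f y‖ ^ 2 }

theorem rightReg_apply (x : Γ) (f : ell2 Γ) (y : Γ) : rightReg x f y = f (y * x) := rfl

theorem rightReg_delta (x y : Γ) : rightReg x (delta y) = delta (y * x⁻¹) := by
  refine lp.ext (funext fun z => ?_)
  rw [rightReg_apply, delta_apply, delta_apply]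
  classical exact if_congr eq_mul_inv_iff_mul_eq.symm rfl rfl

theorem apply_delta_of_mem_groupVN {a : ell2 Γ →L[ℂ] ell2 Γ} (ha : a ∈ (groupVN Γ).toStarSubalgebra)
    (z y : Γ) : a (delta y) z = a (delta 1) (z * y⁻¹) := by
  have hcomm := mem_groupVN_iff.1 ha (rightReg y⁻¹) fun x => by
    ext f w
    simp [leftReg_apply, rightReg_apply, mul_assoc]
  have h := congrArg (fun b => (b (delta 1) : ell2 Γ) z) hcomm
  simpa [rightReg_apply, rightReg_delta] using h.symm

/-- `A` is a C⋆-algebra between `C*_r(Γ)` and `λ(Γ)''`. -/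
structure IsIntermediate (A : StarSubalgebra ℂ (ell2 Γ →L[ℂ] ell2 Γ)) : Prop where
  leftReg_mem (x : Γ) : leftReg x ∈ A
  isClosed : IsClosed (A : Set (ell2 Γ →L[ℂ] ell2 Γ))
  le_groupVN : A ≤ (groupVN Γ).toStarSubalgebra

theorem isIntermediate_groupVN : IsIntermediate (groupVN Γ).toStarSubalgebra where
  leftReg_mem _ := mem_groupVN_iff.2 fun _ hb => (hb _).symm
  isClosed := isClosed_groupVN
  le_groupVN := le_rfl

theorem isIntermediate_reducedCStar : IsIntermediate (reducedCStar Γ) where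
  leftReg_mem x :=
    StarSubalgebra.le_topologicalClosure _ (StarAlgebra.subset_adjoin ℂ _ ⟨x, rfl⟩)
  isClosed := StarSubalgebra.isClosed_topologicalClosure _
  le_groupVN := by
    refine StarSubalgebra.topologicalClosure_minimal ?_ isClosed_groupVN
    rw [StarAlgebra.adjoin_le_iff]
    rintro _ ⟨x, rfl⟩
    exact isIntermediate_groupVN.leftReg_mem x

theorem IsIntermediate.inner_delta {A : StarSubalgebra ℂ (ell2 Γ →L[ℂ] ell2 Γ)}
    (hA : IsIntermediate A) (a : A) (z y : Γ) :
    ⟪delta z, (a : ell2 Γ →L[ℂ] ell2 Γ) (delta y)⟫_ℂ =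
      (a : ell2 Γ →L[ℂ] ell2 Γ) (delta 1) (z * y⁻¹) := by
  rw [inner_delta_left, apply_delta_of_mem_groupVN (hA.le_groupVN a.2)]

end RegularRepresentation

section Twisting

variable {Γ : Type*} [Group Γ] {n : ℕ}

theorem hasSum_norm_sq_slice (p : Fin n → Γ) (v : PiLp 2 fun _ : Fin n => ell2 Γ) :
    HasSum (fun x => ‖(WithLp.toLp 2 fun i => v i (p i * x) : EuclideanSpace ℂ (Fin n))‖ ^ 2)
      (‖v‖ ^ 2) := by
  simp only [EuclideanSpace.norm_sq_eq, PiLp.norm_sq_eq_of_L2]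
  exact hasSum_sum fun i _ => (Equiv.mulLeft (p i)).hasSum_iff.2 (hasSum_norm_sq (v i))

/-- Conjugation by the unitary `⨁ λ(pᵢ)` turns this operator into `m ⊗ 1`. -/
theorem norm_matrixOp_smul_leftReg_le (p : Fin n → Γ) (m : Matrix (Fin n) (Fin n) ℂ) :
    ‖matrixOp (Matrix.of fun i j => m i j • leftReg (p i * (p j)⁻¹))‖ ≤ ‖m‖ := by
  refine ContinuousLinearMap.opNorm_le_bound _ (norm_nonneg m) fun v => ?_
  have hslice (x : Γ) : (fun i => matrixOp (Matrix.of fun i j =>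
      m i j • leftReg (p i * (p j)⁻¹)) v i (p i * x)) = m.mulVec fun i => v i (p i * x) := by
    ext i
    rw [← inner_delta_left, matrixOp_apply, inner_sum]
    simp [inner_smul_right, inner_delta_left, leftReg_apply, Matrix.mulVec, dotProduct, mul_assoc]
  refine (sq_le_sq₀ (norm_nonneg _) (by positivity)).1 ?_
  rw [mul_pow]
  refine hasSum_le (fun x => ?_) (hasSum_norm_sq_slice p _) ((hasSum_norm_sq_slice p v).mul_left _)
  rw [hslice, ← mul_pow]
  gcongr
  exact Matrix.l2_opNorm_mulVec m (WithLp.toLp 2 fun i => v i (p i * x))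

end Twisting

section HerzSchur

variable {Γ : Type*} [Group Γ]

/-- The Schur product of `m` with the matrix `φ(pₛ pₜ⁻¹)`. -/
def schurMul {n : ℕ} (φ : Γ → ℂ) (p : Fin n → Γ) (m : Matrix (Fin n) (Fin n) ℂ) :
    Matrix (Fin n) (Fin n) ℂ :=
  Matrix.of fun s t => φ (p s * (p t)⁻¹) * m s t

/-- The Herz–Schur norm of `φ`: the norm of Schur multiplication by the kernel `φ(x y⁻¹)`, for the
operator norm of matrices. The points `pₛ` may repeat, which builds in all matrix amplifications:
this norm is automatically the completely bounded one. -/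
def herzSchurNorm (φ : Γ → ℂ) : ℝ≥0∞ :=
  ⨆ (n : ℕ) (p : Fin n → Γ) (m : Matrix (Fin n) (Fin n) ℂ) (_ : ‖m‖ ≤ 1), ‖schurMul φ p m‖ₑ

theorem enorm_schurMul_le {n : ℕ} (φ : Γ → ℂ) (p : Fin n → Γ) (m : Matrix (Fin n) (Fin n) ℂ) :
    ‖schurMul φ p m‖ₑ ≤ herzSchurNorm φ * ‖m‖ₑ := by
  refine enorm_le_mul_enorm_of_homogeneous (f := schurMul φ p) (g := id) (fun c m => ?_)
    (fun _ _ => rfl) (fun m hm => ?_) (fun m hm => ?_) m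
  · ext s t
    simp [schurMul, mul_left_comm]
  · rw [id_eq] at hm
    ext s t
    simp [schurMul, hm]
  · exact le_iSup_of_le n (le_iSup₂_of_le p m (le_iSup_of_le hm le_rfl))

theorem herzSchurNorm_le {φ : Γ → ℂ} {C : ℝ≥0∞}
    (h : ∀ (n : ℕ) (p : Fin n → Γ) (m : Matrix (Fin n) (Fin n) ℂ),
      ‖schurMul φ p m‖ₑ ≤ C * ‖m‖ₑ) : herzSchurNorm φ ≤ C :=
  iSup_le fun n => iSup₂_le fun p m => iSup_le fun hm => (h n p m).trans <|
    mul_le_of_le_one_right' (by rwa [← ofReal_norm, ENNReal.ofReal_le_one])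

theorem herzSchurNorm_sub_le (φ ψ : Γ → ℂ) :
    herzSchurNorm (φ - ψ) ≤ herzSchurNorm φ + herzSchurNorm ψ :=
  herzSchurNorm_le fun n p m => by
    have hsub : schurMul (φ - ψ) p m = schurMul φ p m - schurMul ψ p m := by
      ext s t
      simp [schurMul, sub_mul]
    rw [hsub, add_mul]
    exact enorm_sub_le.trans (add_le_add (enorm_schurMul_le φ p m) (enorm_schurMul_le ψ p m))

theorem herzSchurNorm_smul_le (c : ℂ) (φ : Γ → ℂ) :
    herzSchurNorm (c • φ) ≤ ‖c‖ₑ * herzSchurNorm φ :=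
  herzSchurNorm_le fun n p m => by
    have hsmul : schurMul (c • φ) p m = c • schurMul φ p m := by
      ext s t
      simp [schurMul, mul_assoc]
    rw [hsmul, enorm_smul, mul_assoc]
    gcongr
    exact enorm_schurMul_le φ p m

theorem herzSchurNorm_one_le : herzSchurNorm (1 : Γ → ℂ) ≤ 1 :=
  herzSchurNorm_le fun n p m => by
    have hone : schurMul 1 p m = m := by
      ext s t
      simp [schurMul]
    rw [hone, one_mul]

theorem enorm_le_herzSchurNorm_mul {K X : Type*} [NormedAddCommGroup K] [InnerProductSpace ℂ K]
    (b : HilbertBasis X ℂ K) (p : X → Γ) {φ : Γ → ℂ} {A B : K →L[ℂ] K}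
    (h : ∀ s t, ⟪b s, B (b t)⟫_ℂ = φ (p s * (p t)⁻¹) * ⟪b s, A (b t)⟫_ℂ) :
    ‖B‖ₑ ≤ herzSchurNorm φ * ‖A‖ₑ :=
  enorm_le_of_enorm_compression_le b B fun n q => by
    have hschur : compression B (b ∘ q) = schurMul φ (p ∘ q) (compression A (b ∘ q)) := by
      ext s t
      exact h (q s) (q t)
    rw [hschur]
    refine (enorm_schurMul_le _ _ _).trans ?_
    gcongr
    exact enorm_le_iff_norm_le.2 (norm_compression_le A (b.orthonormal.comp q q.injective))

variable {A : StarSubalgebra ℂ (ell2 Γ →L[ℂ] ell2 Γ)}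

/-- The symbol of `T`: the function `x ↦ ⟨T(λ(x)) δ₁, δₓ⟩`, which is `φ` when `T` is the
multiplication operator `λ(x) ↦ φ(x) λ(x)`. -/
def symbol (hA : IsIntermediate A) (T : A →L[ℂ] A) (x : Γ) : ℂ :=
  (T ⟨leftReg x, hA.leftReg_mem x⟩ : ell2 Γ →L[ℂ] ell2 Γ) (delta 1) x

theorem herzSchurNorm_symbol_le (hA : IsIntermediate A) (T : A →L[ℂ] A) :
    herzSchurNorm (symbol hA T) ≤ cbNorm T :=
  herzSchurNorm_le fun n p m => by
    let twist : Matrix (Fin n) (Fin n) A := Matrix.of fun s t =>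
      m s t • ⟨leftReg (p s * (p t)⁻¹), hA.leftReg_mem _⟩
    let Ttwist := matrixOp (twist.map fun x => (T x : ell2 Γ →L[ℂ] ell2 Γ))
    let e (s : Fin n) := amplifiedBasis (delta (Γ := Γ)) n (s, p s)
    have he : Orthonormal ℂ e := (amplifiedBasis delta n).orthonormal.comp (fun s => (s, p s))
      fun s t hst => congrArg Prod.fst hst
    have hcomp : compression Ttwist e = schurMul (symbol hA T) p m := by
      ext s t
      have hT : T (twist s t) = m s t • T ⟨leftReg (p s * (p t)⁻¹), hA.leftReg_mem _⟩ :=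
        map_smul T _ _
      simp [compression, hT, Ttwist, e, amplifiedBasis_apply, inner_single_left, matrixOp_single,
        hA.inner_delta, schurMul, symbol, mul_comm]
    calc ‖schurMul (symbol hA T) p m‖ₑ ≤ ‖Ttwist‖ₑ :=
          hcomp ▸ enorm_le_iff_norm_le.2 (norm_compression_le Ttwist he)
      _ ≤ cbNorm T * ‖matrixOp (twist.map fun x => (x : ell2 Γ →L[ℂ] ell2 Γ))‖ₑ :=
          enorm_matrixOp_map_le T twist
      _ ≤ cbNorm T * ‖m‖ₑ := by
          gcongr
          exact enorm_le_iff_norm_le.2 (norm_matrixOp_smul_leftReg_le p m)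

end HerzSchur

theorem sum_sum_sum_single_smul {Γ : Type*} {n : ℕ} (q : Fin n → Fin n → Γ) (d : Fin n → Fin n → ℂ)
    {E : Type*} [AddCommGroup E] [Module ℂ E] (θ : Γ → E) :
    ((∑ s, ∑ t, Finsupp.single (q s t) (d s t)).sum fun x a => a • θ x) =
      ∑ s, ∑ t, d s t • θ (q s t) := by
  simp_rw [← Finsupp.linearCombination_apply, map_sum, Finsupp.linearCombination_single]

section FourierNorm

variable {Γ : Type*} [Group Γ]

theorem enorm_le_of_enorm_inner_le {E K : Type*} [NormedAddCommGroup E] [InnerProductSpace ℂ E]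
    [NormedAddCommGroup K] [InnerProductSpace ℂ K] {T : E →L[ℂ] K} {C : ℝ≥0∞}
    (h : ∀ v w, ‖⟪w, T v⟫_ℂ‖ₑ ≤ C * ‖v‖ₑ * ‖w‖ₑ) : ‖T‖ₑ ≤ C := by
  rcases eq_or_ne C ∞ with rfl | hC
  · exact le_top
  rw [← ofReal_norm, ENNReal.ofReal_le_iff_le_toReal hC]
  refine opNorm_le_of_norm_inner_le ENNReal.toReal_nonneg fun v w => ?_
  simpa using ENNReal.toReal_mono (by finiteness) (h v w)

theorem enorm_inner_le {E : Type*} [NormedAddCommGroup E] [InnerProductSpace ℂ E] (v w : E) :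
    ‖⟪v, w⟫_ℂ‖ₑ ≤ ‖v‖ₑ * ‖w‖ₑ := by
  simp only [enorm_eq_nnnorm]
  exact_mod_cast nnnorm_inner_le_nnnorm (𝕜 := ℂ) v w

theorem inner_delta_sum_leftReg (c : Γ →₀ ℂ) (z y : Γ) :
    ⟪delta z, (c.sum fun x a => a • leftReg x) (delta y)⟫_ℂ = c (z * y⁻¹) := by
  classical
  simp only [Finsupp.sum, sum_apply, smul_apply,
    leftReg_delta, inner_sum, inner_smul_right, orthonormal_iff_ite.1 delta.orthonormal,
    ← mul_inv_eq_iff_eq_mul, mul_ite, mul_one, mul_zero, Finset.sum_ite_eq]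
  simp +contextual

theorem enorm_apply_le_enorm_sum_leftReg (c : Γ →₀ ℂ) (x : Γ) :
    ‖c x‖ₑ ≤ ‖c.sum fun x a => a • leftReg x‖ₑ := by
  have hx := inner_delta_sum_leftReg c x 1
  rw [inv_one, mul_one] at hx
  rw [← hx, enorm_le_iff_norm_le]
  refine (norm_inner_le_norm _ _).trans ?_
  simpa [norm_delta] using (c.sum fun x a => a • leftReg x).le_opNorm (delta 1)

theorem enorm_sum_mul_le (u : Γ → ℂ) (c : Γ →₀ ℂ) :
    ‖c.sum fun x a => a * u x‖ₑ ≤ fourierNorm u * ‖c.sum fun x a => a • leftReg x‖ₑ := by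
  refine enorm_le_mul_enorm_of_homogeneous (f := fun c : Γ →₀ ℂ => c.sum fun x a => a * u x)
    (g := fun c => c.sum fun x a => a • leftReg x) (fun a c => ?_) (fun a c => ?_)
    (fun c hc => ?_) (fun c hc => le_iSup₂_of_le c hc le_rfl) c
  · rw [Finsupp.sum_smul_index (by simp), smul_eq_mul, Finsupp.mul_sum]
    simp only [mul_assoc]
  · rw [Finsupp.sum_smul_index (by simp), Finsupp.smul_sum]
    simp only [mul_smul]
  · have h0 : c = 0 := by
      ext x
      have hx := enorm_le_iff_norm_le.1 (enorm_apply_le_enorm_sum_leftReg c x)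
      rwa [show (c.sum fun x a => a • leftReg x) = 0 from hc, norm_zero, norm_le_zero_iff] at hx
    simp [h0]

theorem fourierNorm_le {u : Γ → ℂ} {C : ℝ≥0∞} (h : ∀ c : Γ →₀ ℂ,
    ‖c.sum fun x a => a * u x‖ₑ ≤ C * ‖c.sum fun x a => a • leftReg x‖ₑ) : fourierNorm u ≤ C :=
  iSup₂_le fun c hc => (h c).trans <|
    mul_le_of_le_one_right' (by rwa [← ofReal_norm, ENNReal.ofReal_le_one])

theorem fourierNorm_add_le (u v : Γ → ℂ) : fourierNorm (u + v) ≤ fourierNorm u + fourierNorm v :=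
  fourierNorm_le fun c => by
    simp only [Pi.add_apply, mul_add, Finsupp.sum_add]
    rw [add_mul]
    exact (enorm_add_le _ _).trans (add_le_add (enorm_sum_mul_le u c) (enorm_sum_mul_le v c))

theorem enorm_apply_le_fourierNorm (u : Γ → ℂ) (x : Γ) : ‖u x‖ₑ ≤ fourierNorm u :=
  le_iSup₂_of_le (Finsupp.single x 1) (by simpa using norm_leftReg_le x) (by simp)

theorem fourierNorm_coeff_le (f g : ell2 Γ) : fourierNorm (coeff f g) ≤ ‖f‖ₑ * ‖g‖ₑ :=
  fourierNorm_le fun c => by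
    have hc : (c.sum fun x a => a * coeff f g x) = ⟪g, (c.sum fun x a => a • leftReg x) f⟫_ℂ := by
      simp [Finsupp.sum, coeff]
    rw [hc, mul_right_comm, mul_comm _ ‖g‖ₑ, mul_comm ‖f‖ₑ]
    refine (enorm_inner_le _ _).trans ?_
    gcongr
    exact ContinuousLinearMap.le_opENorm _ _

theorem fourierNorm_mul_le (θ u : Γ → ℂ) :
    fourierNorm (θ * u) ≤ herzSchurNorm θ * fourierNorm u :=
  fourierNorm_le fun c => by
    let d : Γ →₀ ℂ := Finsupp.onFinset c.support (fun x => θ x * c x) (by simp +contextual)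
    have hd : (c.sum fun x a => a * (θ * u) x) = d.sum fun x a => a * u x := by
      rw [Finsupp.onFinset_sum _ (by simp), Finsupp.sum]
      exact Finset.sum_congr rfl fun x _ => by rw [Pi.mul_apply]; ring
    have hnorm : ‖d.sum fun x a => a • leftReg x‖ₑ ≤
        herzSchurNorm θ * ‖c.sum fun x a => a • leftReg x‖ₑ :=
      enorm_le_herzSchurNorm_mul delta id fun s t => by
        simp only [inner_delta_sum_leftReg, d, Finsupp.onFinset_apply, id]
    calc ‖c.sum fun x a => a * (θ * u) x‖ₑ
        ≤ fourierNorm u * ‖d.sum fun x a => a • leftReg x‖ₑ := hd ▸ enorm_sum_mul_le u d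
      _ ≤ fourierNorm u * (herzSchurNorm θ * ‖c.sum fun x a => a • leftReg x‖ₑ) := by gcongr
      _ = herzSchurNorm θ * fourierNorm u * ‖c.sum fun x a => a • leftReg x‖ₑ := by ring

theorem fourierNorm_le_sum {u : Γ → ℂ} {K : Finset Γ} (hu : ∀ x ∉ K, u x = 0) :
    fourierNorm u ≤ ∑ x ∈ K, ‖u x‖ₑ :=
  fourierNorm_le fun c => by
    classical
    have hc : (c.sum fun x a => a * u x) = ∑ x ∈ K, c x * u x :=
      (Finsupp.sum_of_support_subset c (s := c.support ∪ K) Finset.subset_union_left _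
        (by simp)).trans (Finset.sum_subset Finset.subset_union_right fun x _ hx => by
          rw [hu x hx, mul_zero]).symm
    rw [hc, Finset.sum_mul]
    refine (enorm_sum_le _ _).trans (Finset.sum_le_sum fun x _ => ?_)
    rw [enorm_mul, mul_comm]
    gcongr
    exact enorm_apply_le_enorm_sum_leftReg c x

theorem norm_sum_sum_smul_leftReg_le {n : ℕ} (p : Fin n → Γ) (m : Matrix (Fin n) (Fin n) ℂ)
    (v w : EuclideanSpace ℂ (Fin n)) :
    ‖∑ s, ∑ t, (conj (w s) * v t * m s t) • leftReg (p s * (p t)⁻¹)‖ ≤ ‖m‖ * ‖v‖ * ‖w‖ := by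
  have hnorm (v : EuclideanSpace ℂ (Fin n)) (f : ell2 Γ) :
      ‖(WithLp.toLp 2 fun t => v t • f : PiLp 2 fun _ : Fin n => ell2 Γ)‖ = ‖v‖ * ‖f‖ := by
    rw [← sq_eq_sq₀ (norm_nonneg _) (by positivity), PiLp.norm_sq_eq_of_L2, mul_pow,
      EuclideanSpace.norm_sq_eq, Finset.sum_mul]
    simp [norm_smul, mul_pow]
  refine opNorm_le_of_norm_inner_le (by positivity) fun f g => ?_
  set B := matrixOp (Matrix.of fun s t => m s t • leftReg (p s * (p t)⁻¹))
  have hinner : ⟪g, (∑ s, ∑ t, (conj (w s) * v t * m s t) • leftReg (p s * (p t)⁻¹)) f⟫_ℂ =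
      ⟪WithLp.toLp 2 fun s => w s • g, B (WithLp.toLp 2 fun t => v t • f)⟫_ℂ := by
    simp [PiLp.inner_apply, B, matrixOp_apply, inner_sum, inner_smul_left, inner_smul_right,
      mul_assoc, mul_left_comm]
  rw [hinner]
  calc _ ≤ ‖w‖ * ‖g‖ * (‖m‖ * (‖v‖ * ‖f‖)) := by
        rw [← hnorm, ← hnorm]
        refine (norm_inner_le_norm _ _).trans ?_
        gcongr
        exact B.le_of_opNorm_le (norm_matrixOp_smul_leftReg_le p m) _
    _ = ‖m‖ * ‖v‖ * ‖w‖ * ‖f‖ * ‖g‖ := by ring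

theorem herzSchurNorm_le_fourierNorm (u : Γ → ℂ) : herzSchurNorm u ≤ fourierNorm u :=
  herzSchurNorm_le fun n p m => by
    refine enorm_le_of_enorm_inner_le
      (T := Matrix.toEuclideanCLM (𝕜 := ℂ) (schurMul u p m)) fun v w => ?_
    let d (s t : Fin n) : ℂ := conj (w s) * v t * m s t
    let c : Γ →₀ ℂ := ∑ s, ∑ t, Finsupp.single (p s * (p t)⁻¹) (d s t)
    have hinner : ⟪w, Matrix.toEuclideanCLM (𝕜 := ℂ) (schurMul u p m) v⟫_ℂ =
        c.sum fun x a => a * u x := by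
      refine Eq.trans ?_ (sum_sum_sum_single_smul _ _ u).symm
      simp only [PiLp.inner_apply, RCLike.inner_apply, Matrix.ofLp_toEuclideanCLM, Matrix.mulVec,
        dotProduct, schurMul, Matrix.of_apply, Finset.sum_mul, smul_eq_mul, d]
      exact Finset.sum_congr rfl fun s _ => Finset.sum_congr rfl fun t _ => by ring
    have hnorm : ‖c.sum fun x a => a • leftReg x‖ₑ ≤ ‖m‖ₑ * ‖v‖ₑ * ‖w‖ₑ := by
      rw [sum_sum_sum_single_smul _ _ leftReg]
      simp only [enorm_eq_nnnorm]
      exact_mod_cast norm_sum_sum_smul_leftReg_le p m v w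
    calc _ ≤ fourierNorm u * ‖c.sum fun x a => a • leftReg x‖ₑ := hinner ▸ enorm_sum_mul_le u c
      _ ≤ fourierNorm u * (‖m‖ₑ * ‖v‖ₑ * ‖w‖ₑ) := by gcongr
      _ = fourierNorm u * ‖m‖ₑ * ‖v‖ₑ * ‖w‖ₑ := by ring

end FourierNorm

section Density

variable {Γ : Type*} [Group Γ]

theorem coeff_sub_coeff (f g f' g' : ell2 Γ) :
    coeff f g - coeff f' g' = coeff (f - f') g + coeff f' (g - g') := by
  ext x
  simp [coeff]

theorem finite_support_coeff_sum_delta (F : Finset Γ) (a b : Γ → ℂ) :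
    (coeff (∑ y ∈ F, a y • delta y) (∑ z ∈ F, b z • delta z)).support.Finite := by
  classical
  refine (F.finite_toSet.mul F.finite_toSet.inv).subset fun x hx => ?_
  by_contra hxF
  refine hx ?_
  simp only [coeff, map_sum, map_smul, leftReg_delta, sum_inner, inner_sum, inner_smul_left,
    inner_smul_right, orthonormal_iff_ite.1 delta.orthonormal]
  refine Finset.sum_eq_zero fun y hy => mul_eq_zero_of_right _ <|
    Finset.sum_eq_zero fun z hz => ?_
  rw [if_neg, mul_zero]
  rintro rfl
  exact hxF ⟨x * y, hz, y⁻¹, by simpa using hy, by simp⟩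

theorem exists_finite_support_fourierNorm_sub_le {ψ : Γ → ℂ} (hψ : ψ ∈ fourierAlgebra Γ)
    {ε : ℝ≥0∞} (hε : ε ≠ 0) :
    ∃ v : Γ → ℂ, v.support.Finite ∧ fourierNorm (ψ - v) ≤ ε := by
  obtain ⟨f, g, rfl⟩ := hψ
  let truncate (h : ell2 Γ) (F : Finset Γ) : ell2 Γ := ∑ x ∈ F, h x • delta x
  have hlim (h : ell2 Γ) : Tendsto (fun F => truncate h F) atTop (𝓝 h) := hasSum_delta h
  have hzero (h : ell2 Γ) : Tendsto (fun F => ‖h - truncate h F‖ₑ) atTop (𝓝 0) := by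
    simpa using ((tendsto_const_nhds (x := h)).sub (hlim h)).enorm
  have hbound : Tendsto (fun F => ‖f - truncate f F‖ₑ * ‖g‖ₑ +
      ‖truncate f F‖ₑ * ‖g - truncate g F‖ₑ) atTop (𝓝 0) := by
    simpa using (ENNReal.Tendsto.mul_const (hzero f) (.inr enorm_ne_top)).add
      (ENNReal.Tendsto.mul (hlim f).enorm (.inr (by simp)) (hzero g) (.inr enorm_ne_top))
  obtain ⟨F, hF⟩ := (hbound.eventually_le_const (pos_iff_ne_zero.2 hε)).exists
  refine ⟨coeff (truncate f F) (truncate g F), finite_support_coeff_sum_delta F f g, ?_⟩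
  rw [coeff_sub_coeff]
  exact (fourierNorm_add_le _ _).trans
    ((add_le_add (fourierNorm_coeff_le _ _) (fourierNorm_coeff_le _ _)).trans hF)

theorem mem_fourierAlgebra_of_memℓp {u : Γ → ℂ} (hu : Memℓp u 2) : u ∈ fourierAlgebra Γ := by
  have hinv : Memℓp (fun x => u x⁻¹) 2 :=
    memℓp_two_iff.2 ((memℓp_two_iff.1 hu).comp_injective inv_injective)
  exact ⟨⟨_, hinv⟩, delta 1, funext fun x => by simp [coeff, inner_delta_left, leftReg_apply]⟩

end Density

section Bicommutant

section Cyclic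

variable {K : Type*} [NormedAddCommGroup K] [InnerProductSpace ℂ K] [CompleteSpace K]

/-- The closed cyclic subspace generated by the vector `v` under the operator algebra `B`. -/
def cyclicSubspace (B : StarSubalgebra ℂ (K →L[ℂ] K)) (v : K) : Submodule ℂ K :=
  ((Subalgebra.toSubmodule B.toSubalgebra).map
    (ContinuousLinearMap.apply ℂ K v : (K →L[ℂ] K) →ₗ[ℂ] K)).topologicalClosure

instance (B : StarSubalgebra ℂ (K →L[ℂ] K)) (v : K) : CompleteSpace (cyclicSubspace B v) :=
  (Submodule.isClosed_topologicalClosure _).completeSpace_coe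

variable {B : StarSubalgebra ℂ (K →L[ℂ] K)} {b : K →L[ℂ] K}

theorem apply_mem_cyclicSubspace (hb : b ∈ B) (v : K) : b v ∈ cyclicSubspace B v :=
  Submodule.le_topologicalClosure _ ⟨b, hb, rfl⟩

theorem cyclicSubspace_le {v : K} {L : Submodule ℂ K} (hL : IsClosed (L : Set K))
    (h : ∀ b ∈ B, b v ∈ L) : cyclicSubspace B v ≤ L :=
  Submodule.topologicalClosure_minimal _ (by rintro _ ⟨b, hb, rfl⟩; exact h b hb) hL

theorem cyclicSubspace_mem_invtSubmodule (hb : b ∈ B) (v : K) :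
    cyclicSubspace B v ∈ Module.End.invtSubmodule b.toLinearMap :=
  cyclicSubspace_le ((Submodule.isClosed_topologicalClosure _).preimage b.continuous) fun _ hc =>
    apply_mem_cyclicSubspace (mul_mem hb hc) v

theorem commute_starProjection_cyclicSubspace (hb : b ∈ B) (v : K) :
    Commute (cyclicSubspace B v).starProjection b := by
  rw [ContinuousLinearMap.IsIdempotentElem.commute_iff
    (cyclicSubspace B v).isIdempotentElem_starProjection, Submodule.range_starProjection,
    Submodule.ker_starProjection]
  exact ⟨cyclicSubspace_mem_invtSubmodule hb v, ContinuousLinearMap.orthogonal_mem_invtSubmodule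
    (cyclicSubspace_mem_invtSubmodule (star_mem hb) v)⟩

end Cyclic

variable {H : Type*} [NormedAddCommGroup H] [InnerProductSpace ℂ H] {n : ℕ}

theorem matrixOp_diagonal_apply (a : H →L[ℂ] H) (v : PiLp 2 fun _ : Fin n => H) (i : Fin n) :
    matrixOp (Matrix.diagonal fun _ => a) v i = a (v i) := by
  rw [matrixOp_apply, Finset.sum_eq_single i (fun j _ hji => by simp [hji.symm]) (by simp),
    Matrix.diagonal_apply_eq]

variable [CompleteSpace H]

variable (H n) in
/-- The amplification `a ↦ a ⊕ ⋯ ⊕ a` to `n` copies of `H`. -/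
def diagonalOp : (H →L[ℂ] H) →⋆ₐ[ℂ]
    (PiLp 2 (fun _ : Fin n => H) →L[ℂ] PiLp 2 fun _ : Fin n => H) where
  toFun a := matrixOp (Matrix.diagonal fun _ => a)
  map_one' := by ext v i; exact matrixOp_diagonal_apply 1 v i
  map_mul' a b := by ext v i; simp [matrixOp_diagonal_apply]
  map_zero' := by ext v i; exact matrixOp_diagonal_apply 0 v i
  map_add' a b := by ext v i; simp [matrixOp_diagonal_apply]
  commutes' c := by ext v i; simp [matrixOp_diagonal_apply, Algebra.algebraMap_eq_smul_one]
  map_star' a := by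
    rw [ContinuousLinearMap.star_eq_adjoint, ContinuousLinearMap.star_eq_adjoint,
      ContinuousLinearMap.eq_adjoint_iff]
    intro v w
    simp [PiLp.inner_apply, matrixOp_diagonal_apply, ContinuousLinearMap.adjoint_inner_left]

theorem diagonalOp_apply (a : H →L[ℂ] H) (v : PiLp 2 fun _ : Fin n => H) (i : Fin n) :
    diagonalOp H n a v i = a (v i) :=
  matrixOp_diagonal_apply a v i

theorem diagonalOp_single (a : H →L[ℂ] H) (j : Fin n) (h : H) :
    diagonalOp H n a (PiLp.single 2 j h) = PiLp.single 2 j (a h) := by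
  ext i
  by_cases hij : i = j
  · subst hij; simp [diagonalOp_apply]
  · simp [diagonalOp_apply, hij]

theorem commute_diagonalOp_of_mem_bicommutant {S : Set (H →L[ℂ] H)}
    {P : PiLp 2 (fun _ : Fin n => H) →L[ℂ] PiLp 2 fun _ : Fin n => H}
    (hP : ∀ b ∈ S, Commute P (diagonalOp H n b)) {a : H →L[ℂ] H}
    (ha : a ∈ Set.centralizer (Set.centralizer S)) : Commute P (diagonalOp H n a) := by
  let block (i j : Fin n) : H →L[ℂ] H := PiLp.proj 2 (fun _ : Fin n => H) i ∘L P ∘L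
    ((PiLp.continuousLinearEquiv 2 ℂ (fun _ : Fin n => H)).symm :
      (Fin n → H) →L[ℂ] PiLp 2 fun _ : Fin n => H) ∘L
    ContinuousLinearMap.single ℂ (fun _ : Fin n => H) j
  have hblock (i j : Fin n) (h : H) : block i j h = P (PiLp.single 2 j h) i := rfl
  have hcomm (i j : Fin n) : block i j ∈ Set.centralizer S := fun b hb => by
    ext h
    simpa [hblock, diagonalOp_single, diagonalOp_apply] using
      congrArg (fun T => T (PiLp.single 2 j h) i) (hP b hb).eq.symm
  have hsingle (i j : Fin n) (h : H) :
      P (PiLp.single 2 j (a h)) i = a (P (PiLp.single 2 j h) i) :=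
    congrArg (fun T => T h) (ha _ (hcomm i j))
  ext v i
  have hv : v = ∑ j, PiLp.single 2 j (v j) := by
    ext i; simp [Pi.single_apply]
  rw [hv]
  simp [diagonalOp_apply, diagonalOp_single, hsingle]

/-- Von Neumann's argument: the projection onto the cyclic subspace of `(v₁, …, vₙ)` under the
amplification of `A` commutes with that amplification, hence with `a ⊕ ⋯ ⊕ a`. -/
theorem sum_inner_eq_zero_of_mem_bicommutant {A : StarSubalgebra ℂ (H →L[ℂ] H)} {v w : Fin n → H}
    (h : ∀ b ∈ A, ∑ i, ⟪w i, b (v i)⟫_ℂ = 0) {a : H →L[ℂ] H}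
    (ha : a ∈ Set.centralizer (Set.centralizer (A : Set (H →L[ℂ] H)))) :
    ∑ i, ⟪w i, a (v i)⟫_ℂ = 0 := by
  have hinner (b : H →L[ℂ] H) : ⟪WithLp.toLp 2 w, diagonalOp H n b (WithLp.toLp 2 v)⟫_ℂ =
      ∑ i, ⟪w i, b (v i)⟫_ℂ := by
    simp [PiLp.inner_apply, diagonalOp_apply]
  let V : PiLp 2 fun _ : Fin n => H := WithLp.toLp 2 v
  let K := cyclicSubspace (A.map (diagonalOp H n)) V
  have hV : V ∈ K := by
    simpa using apply_mem_cyclicSubspace (one_mem (A.map (diagonalOp H n))) V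
  have hcomm : Commute K.starProjection (diagonalOp H n a) :=
    commute_diagonalOp_of_mem_bicommutant (fun b hb =>
      commute_starProjection_cyclicSubspace (StarSubalgebra.mem_map.2 ⟨b, hb, rfl⟩) V) ha
  have haV : diagonalOp H n a V ∈ K := by
    rw [← Submodule.starProjection_eq_self_iff.2 hV]
    exact (congrArg (fun T => T V) hcomm.eq) ▸ K.starProjection_apply_mem _
  have hK : K ≤ (innerSL ℂ (WithLp.toLp 2 w)).toLinearMap.ker :=
    cyclicSubspace_le (innerSL ℂ (WithLp.toLp 2 w)).isClosed_ker (by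
      rintro _ ⟨b, hb, rfl⟩
      exact (hinner b).trans (h b hb))
  exact (hinner a).symm.trans (hK haV)

end Bicommutant

section Duality

variable {Γ : Type*} [Group Γ]

theorem adjoin_range_leftReg_eq_span :
    Subalgebra.toSubmodule (StarAlgebra.adjoin ℂ (Set.range (leftReg (Γ := Γ)))).toSubalgebra =
      Submodule.span ℂ (Set.range leftReg) := by
  let L : Γ →* (ell2 Γ →L[ℂ] ell2 Γ) := ⟨⟨leftReg, leftReg_one⟩, leftReg_mul⟩
  have hstar : star (Set.range L) ⊆ Set.range L := by
    rintro b ⟨x, hx⟩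
    exact ⟨x⁻¹, (star_leftReg x).symm.trans (star_eq_iff_star_eq.2 hx.symm)⟩
  rw [StarAlgebra.adjoin_toSubalgebra, show leftReg = L from rfl, Set.union_eq_left.2 hstar,
    Algebra.adjoin_eq_span, ← MonoidHom.coe_mrange, Submonoid.closure_eq]

theorem mem_closure_span_leftReg (a : reducedCStar Γ) :
    a ∈ closure (Submodule.span ℂ (Set.range fun x : Γ =>
      (⟨leftReg x, isIntermediate_reducedCStar.leftReg_mem x⟩ : reducedCStar Γ)) :
        Set (reducedCStar Γ)) := by
  have hspan := Submodule.map_span (Subalgebra.toSubmodule (reducedCStar Γ).toSubalgebra).subtype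
    (Set.range fun x : Γ =>
      (⟨leftReg x, isIntermediate_reducedCStar.leftReg_mem x⟩ : reducedCStar Γ))
  rw [← Set.range_comp] at hspan
  rw [closure_subtype]
  convert (show (a : ell2 Γ →L[ℂ] ell2 Γ) ∈ closure _ from a.2) using 2
  exact congrArg SetLike.coe (hspan.trans adjoin_range_leftReg_eq_span.symm)

theorem inner_eq_of_coeff_eq {f g f' g' : ell2 Γ} (h : coeff f g = coeff f' g')
    {a : ell2 Γ →L[ℂ] ell2 Γ} (ha : a ∈ (groupVN Γ).toStarSubalgebra) :
    ⟪g, a f⟫_ℂ = ⟪g', a f'⟫_ℂ := by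
  let S : Set (ell2 Γ →L[ℂ] ell2 Γ) := Set.range leftReg
  have hspan (b) (hb : b ∈ StarAlgebra.adjoin ℂ S) : ⟪g, b f⟫_ℂ = ⟪g', b f'⟫_ℂ := by
    replace hb : b ∈ Submodule.span ℂ S := adjoin_range_leftReg_eq_span.le hb
    induction hb using Submodule.span_induction with
    | mem b hb =>
      obtain ⟨x, rfl⟩ := hb
      exact congrFun h x
    | zero => simp
    | add b c _ _ hb hc => simp [hb, hc]
    | smul c b _ hb => simp [hb]
  have hbicomm : a ∈ Set.centralizer (Set.centralizer (StarAlgebra.adjoin ℂ S : Set _)) :=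
    fun c hc => mem_groupVN_iff.1 ha c fun x => hc _ (StarAlgebra.subset_adjoin ℂ S ⟨x, rfl⟩)
  have hsum := sum_inner_eq_zero_of_mem_bicommutant (v := ![f, f']) (w := ![g, -g'])
    (fun b hb => by simp [Fin.sum_univ_two, hspan b hb]) hbicomm
  simpa [Fin.sum_univ_two, add_neg_eq_zero] using hsum

end Duality

section Multiplication

variable {Γ : Type*}

theorem summable_and_norm_tsum_mul_smul_le {E : Type*} [NormedAddCommGroup E] [NormedSpace ℂ E]
    [CompleteSpace E] (φ f : ell2 Γ) {v : Γ → E} (hv : ∀ x, ‖v x‖ ≤ 1) :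
    (Summable fun x => (φ x * f x) • v x) ∧ ‖∑' x, (φ x * f x) • v x‖ ≤ ‖φ‖ * ‖f‖ := by
  obtain ⟨hsum, hHolder⟩ := lp.tsum_mul_le_mul_norm (p := 2) (q := 2)
    (by simpa using Real.HolderConjugate.two_two) φ f
  have hbound (x : Γ) : ‖(φ x * f x) • v x‖ ≤ ‖φ x‖ * ‖f x‖ := by
    rw [norm_smul, norm_mul]
    exact mul_le_of_le_one_right (by positivity) (hv x)
  exact ⟨.of_norm_bounded hsum hbound, (tsum_of_norm_bounded hsum.hasSum hbound).trans hHolder⟩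

theorem memℓp_mul_of_bounded {c u : Γ → ℂ} {M : ℝ} (hc : ∀ x, ‖c x‖ ≤ M) (hu : Memℓp u 2) :
    Memℓp (c * u) 2 := by
  refine memℓp_two_iff.2 (((memℓp_two_iff.1 hu).mul_left (M ^ 2)).of_nonneg_of_le
    (fun _ => by positivity) fun x => ?_)
  rw [Pi.mul_apply, norm_mul, mul_pow]
  gcongr
  exact hc x

variable [Group Γ] {A : StarSubalgebra ℂ (ell2 Γ →L[ℂ] ell2 Γ)}

theorem hasSum_mul_smul_leftReg (φ f : ell2 Γ) :
    HasSum (fun x => (φ x * f x) • leftReg x) (∑' x, (φ x * f x) • leftReg x) :=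
  (summable_and_norm_tsum_mul_smul_le φ f norm_leftReg_le).1.hasSum

/-- The multiplication operator `λ(x) ↦ φ(x) λ(x)` with square summable symbol `φ`. -/
def multOp (hA : IsIntermediate A) (φ : ell2 Γ) : A →L[ℂ] A :=
  LinearMap.mkContinuous
    { toFun := fun a => ⟨∑' x, (φ x * (a : ell2 Γ →L[ℂ] ell2 Γ) (delta 1) x) • leftReg x,
        hA.isClosed.mem_of_tendsto (hasSum_mul_smul_leftReg φ _) (.of_forall fun _ =>
          sum_mem fun x _ => A.smul_mem (hA.leftReg_mem x) _)⟩
      map_add' := fun a b => Subtype.ext <| by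
        refine (hasSum_mul_smul_leftReg φ _).unique ?_
        simpa [← add_smul, ← mul_add] using
          (hasSum_mul_smul_leftReg φ _).add (hasSum_mul_smul_leftReg φ _)
      map_smul' := fun c a => Subtype.ext <| by
        refine (hasSum_mul_smul_leftReg φ _).unique ?_
        simpa [smul_smul, mul_left_comm] using (hasSum_mul_smul_leftReg φ _).const_smul c }
    ‖φ‖ fun a => (summable_and_norm_tsum_mul_smul_le φ _ norm_leftReg_le).2.trans <| by
      gcongr
      simpa [norm_delta] using (a : ell2 Γ →L[ℂ] ell2 Γ).le_opNorm (delta 1)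

variable (hA : IsIntermediate A)

theorem hasSum_multOp (φ : ell2 Γ) (a : A) :
    HasSum (fun x => (φ x * (a : ell2 Γ →L[ℂ] ell2 Γ) (delta 1) x) • leftReg x)
      (multOp hA φ a : ell2 Γ →L[ℂ] ell2 Γ) :=
  hasSum_mul_smul_leftReg φ _

theorem hasSum_inner_multOp (φ : ell2 Γ) (a : A) (f g : ell2 Γ) :
    HasSum (fun x => φ x * coeff f g x * (a : ell2 Γ →L[ℂ] ell2 Γ) (delta 1) x)
      ⟪g, (multOp hA φ a : ell2 Γ →L[ℂ] ell2 Γ) f⟫_ℂ := by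
  simpa [coeff, mul_right_comm] using
    ((hasSum_multOp hA φ a).mapL (ContinuousLinearMap.apply ℂ (ell2 Γ) f)).mapL (innerSL ℂ g)

theorem coeff_delta (y z x : Γ) : coeff (delta y) (delta z) x = delta (z * y⁻¹) x := by
  rw [coeff, leftReg_delta, inner_delta_left, delta_apply, delta_apply]
  classical exact if_congr (eq_comm.trans eq_mul_inv_iff_mul_eq.symm) rfl rfl

theorem inner_multOp_delta (φ : ell2 Γ) (a : A) (z y : Γ) :
    ⟪delta z, (multOp hA φ a : ell2 Γ →L[ℂ] ell2 Γ) (delta y)⟫_ℂ =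
      φ (z * y⁻¹) * ⟪delta z, (a : ell2 Γ →L[ℂ] ell2 Γ) (delta y)⟫_ℂ := by
  rw [hA.inner_delta a]
  refine (hasSum_inner_multOp hA φ a (delta y) (delta z)).unique ?_
  convert hasSum_single (z * y⁻¹) fun x hx => ?_ using 1
  · simp [coeff_delta, delta_apply]
  · simp [coeff_delta, delta_apply, hx]

theorem multOp_leftReg (φ : ell2 Γ) (x : Γ) :
    multOp hA φ ⟨leftReg x, hA.leftReg_mem x⟩ = φ x • ⟨leftReg x, hA.leftReg_mem x⟩ := by
  refine Subtype.ext ((hasSum_multOp hA φ _).unique ?_)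
  convert hasSum_single x fun y hy => ?_ using 1
  · simp [leftReg_delta, delta_apply]
  · simp [leftReg_delta, delta_apply, hy]

theorem enorm_multOp_le (φ : ell2 Γ) (a : A) :
    ‖multOp hA φ a‖ₑ ≤ herzSchurNorm φ * ‖a‖ₑ :=
  enorm_le_herzSchurNorm_mul delta id (inner_multOp_delta hA φ a)

theorem cbNorm_multOp_le (φ : ell2 Γ) : cbNorm (multOp hA φ) ≤ herzSchurNorm φ := by
  refine iSup_le fun n => iSup₂_le fun a ha => ?_
  refine (enorm_le_herzSchurNorm_mul (amplifiedBasis delta n) Prod.snd (φ := φ) fun s t => ?_).trans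
    (mul_le_of_le_one_right' (by rwa [← ofReal_norm, ENNReal.ofReal_le_one]))
  simp only [amplifiedBasis_apply, inner_single_left, matrixOp_single]
  exact inner_multOp_delta hA φ _ _ _

theorem memℓp_mul_coeff (φ f g : ell2 Γ) : Memℓp (⇑φ * coeff f g) 2 := by
  have hcoeff (x : Γ) : ‖coeff f g x‖ ≤ ‖g‖ * ‖f‖ :=
    norm_leftReg_apply x f ▸ norm_inner_le_norm g (leftReg x f)
  simpa [mul_comm] using memℓp_mul_of_bounded hcoeff (lp.memℓp φ)

theorem isTransposedMultiplication_multOp (φ : ell2 Γ) :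
    IsTransposedMultiplication φ (multOp isIntermediate_groupVN φ) := by
  intro f g f' g' h a
  let ψ : ell2 Γ := ⟨⇑φ * coeff f g, memℓp_mul_coeff φ f g⟩
  have hcoeff : coeff (delta 1) (star ψ) = coeff f' g' := by
    rw [← h]
    ext x
    rw [coeff, leftReg_delta, mul_one, ← inner_conj_symm, inner_delta_left]
    simp [ψ]
  rw [← inner_eq_of_coeff_eq hcoeff a.2]
  refine (hasSum_inner_multOp _ φ a f g).unique ?_
  have hsum : HasSum (fun x => ⟪(star ψ) x, (a : ell2 Γ →L[ℂ] ell2 Γ) (delta 1) x⟫_ℂ)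
      ⟪star ψ, (a : ell2 Γ →L[ℂ] ell2 Γ) (delta 1)⟫_ℂ := lp.hasSum_inner _ _
  exact hsum.congr_fun fun x => by simp [ψ, mul_comm]

theorem isMultiplier_coe (φ : ell2 Γ) : IsMultiplier φ := by
  rintro _ ⟨f, g, rfl⟩
  exact mem_fourierAlgebra_of_memℓp (memℓp_mul_coeff φ f g)

theorem multiplierCBNorm_le (φ : ell2 Γ) : multiplierCBNorm φ ≤ herzSchurNorm φ :=
  iInf₂_le_of_le (multOp isIntermediate_groupVN φ)
    ⟨isMultiplier_coe φ, isTransposedMultiplication_multOp φ⟩ (cbNorm_multOp_le _ φ)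

theorem herzSchurNorm_le_multiplierCBNorm (φ : Γ → ℂ) : herzSchurNorm φ ≤ multiplierCBNorm φ :=
  le_iInf₂ fun S hS => by
    have hsymbol : symbol isIntermediate_groupVN S = φ := by
      ext x
      have hcoeff : φ * coeff (delta 1) (delta x) = coeff (φ x • delta 1) (delta x) := by
        ext y
        rw [Pi.mul_apply, coeff_delta, coeff, map_smul, inner_smul_right, ← coeff, coeff_delta,
          delta_apply]
        split_ifs with hy
        · simp_all
        · simp
      have htranspose := hS.2 _ _ _ _ hcoeff ⟨leftReg x, isIntermediate_groupVN.leftReg_mem x⟩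
      simpa [symbol, inner_delta_left, leftReg_delta, norm_delta] using htranspose
    exact hsymbol ▸ herzSchurNorm_symbol_le isIntermediate_groupVN S

end Multiplication

section FiniteSupport

variable {Γ : Type*} [Group Γ] {A : StarSubalgebra ℂ (ell2 Γ →L[ℂ] ell2 Γ)}
  (hA : IsIntermediate A) {φ : ell2 Γ}

theorem multOp_eq_sum (hφ : (⇑φ).support.Finite) (a : A) :
    multOp hA φ a = ∑ x ∈ hφ.toFinset, (φ x * (a : ell2 Γ →L[ℂ] ell2 Γ) (delta 1) x) •
      (⟨leftReg x, hA.leftReg_mem x⟩ : A) := by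
  refine Subtype.ext ((hasSum_multOp hA φ a).unique ?_)
  have hzero (x) (hx : x ∉ hφ.toFinset) :
      (φ x * (a : ell2 Γ →L[ℂ] ell2 Γ) (delta 1) x) • leftReg x = 0 := by
    rw [Set.Finite.mem_toFinset, Function.notMem_support] at hx
    rw [hx, zero_mul, zero_smul]
  simpa using hasSum_sum_of_ne_finset_zero hzero

theorem isFiniteRank_multOp (hφ : (⇑φ).support.Finite) : IsFiniteRank (multOp hA φ) := by
  classical
  let S : Finset A := hφ.toFinset.image fun x => ⟨leftReg x, hA.leftReg_mem x⟩
  have hrange : LinearMap.range (multOp hA φ : A →ₗ[ℂ] A) ≤ Submodule.span ℂ (S : Set A) := by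
    rintro _ ⟨a, rfl⟩
    rw [ContinuousLinearMap.coe_coe, multOp_eq_sum hA hφ]
    exact sum_mem fun x hx => Submodule.smul_mem _ _
      (Submodule.subset_span (Finset.mem_image_of_mem _ hx))
  exact Submodule.finiteDimensional_of_le hrange

theorem mem_predual_of_inner {H : Type*} [NormedAddCommGroup H] [InnerProductSpace ℂ H]
    [CompleteSpace H] {M : VonNeumannAlgebra H} {ω : M.toStarSubalgebra →L[ℂ] ℂ} (ξ η : H)
    (h : ∀ a, ω a = ⟪η, (a : H →L[ℂ] H) ξ⟫_ℂ) : ω ∈ predual M := by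
  have hsum (ζ : H) : Summable fun n => ‖(Pi.single 0 ζ : ℕ → H) n‖ ^ 2 :=
    summable_of_ne_finset_zero (s := {0}) fun n hn => by simp_all
  refine ⟨Pi.single 0 ξ, Pi.single 0 η, hsum ξ, hsum η, fun a => ?_⟩
  rw [h, tsum_eq_single 0 fun n hn => by simp [hn], Pi.single_eq_same, Pi.single_eq_same]

theorem isSigmaWeaklyContinuous_multOp (hφ : (⇑φ).support.Finite) :
    IsSigmaWeaklyContinuous (M := groupVN Γ) (multOp isIntermediate_groupVN φ) := by
  have hcomp (ω : (groupVN Γ).toStarSubalgebra →L[ℂ] ℂ) :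
      ω.comp (multOp isIntermediate_groupVN φ) ∈ predual (groupVN Γ) := by
    refine mem_predual_of_inner (delta 1) (∑ x ∈ hφ.toFinset,
      conj (φ x * ω ⟨leftReg x, isIntermediate_groupVN.leftReg_mem x⟩) • delta x) fun a => ?_
    rw [ContinuousLinearMap.comp_apply, multOp_eq_sum _ hφ, map_sum, sum_inner]
    refine Finset.sum_congr rfl fun x _ => ?_
    rw [map_smul, inner_smul_left, inner_delta_left, smul_eq_mul, Complex.conj_conj]
    ring
  refine continuous_iInf_rng.2 fun ω => continuous_iInf_rng.2 fun _ =>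
    continuous_induced_rng.2 ?_
  exact continuous_iInf_dom (i := ω.comp _) (continuous_iInf_dom (i := hcomp ω)
    continuous_induced_dom)

end FiniteSupport

section Convergence

variable {ι : Type*} {l : Filter ι}

theorem tendsto_of_mem_closure_span {E G : Type*} [NormedAddCommGroup E] [NormedSpace ℂ E]
    [NormedAddCommGroup G] [NormedSpace ℂ G] {L : ι → E →L[ℂ] G} {L₀ : E →L[ℂ] G} {C : ℝ}
    (hL : ∀ i, ‖L i‖ ≤ C) {s : Set E} (hs : ∀ v ∈ s, Tendsto (L · v) l (𝓝 (L₀ v))) {v : E}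
    (hv : v ∈ closure (Submodule.span ℂ s : Set E)) : Tendsto (L · v) l (𝓝 (L₀ v)) := by
  have hbdd : (∃ C, ∀ i, ‖L i‖ ≤ C) ↔ Equicontinuous ((↑) ∘ L) :=
    (NormedSpace.equicontinuous_TFAE L).out 5 1
  have hequi : Equicontinuous fun i => ⇑(L i) := hbdd.1 ⟨C, hL⟩
  refine closure_minimal (fun w hw => ?_)
    (hequi.isClosed_setOfPred_tendsto L₀.continuous) hv
  induction hw using Submodule.span_induction with
  | mem w hw => exact hs w hw
  | zero => simpa using tendsto_const_nhds
  | add w w' _ _ h h' => simpa using h.add h'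
  | smul c w _ h => simpa using h.const_smul c

theorem tendsto_inner_of_tendsto_inner_basis {H X : Type*} [NormedAddCommGroup H]
    [InnerProductSpace ℂ H] (e : HilbertBasis X ℂ H) {b : ι → H →L[ℂ] H} {b₀ : H →L[ℂ] H} {C : ℝ}
    (hb : ∀ i, ‖b i‖ ≤ C)
    (h : ∀ s t, Tendsto (fun i => ⟪e s, b i (e t)⟫_ℂ) l (𝓝 ⟪e s, b₀ (e t)⟫_ℂ)) (ξ η : H) :
    Tendsto (fun i => ⟪η, b i ξ⟫_ℂ) l (𝓝 ⟪η, b₀ ξ⟫_ℂ) := by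
  have htotal (ζ : H) : ζ ∈ closure (Submodule.span ℂ (Set.range e) : Set H) := by
    rw [← Submodule.topologicalClosure_coe, e.dense_span]
    trivial
  have hbasis (s : X) : Tendsto (fun i => ⟪e s, b i ξ⟫_ℂ) l (𝓝 ⟪e s, b₀ ξ⟫_ℂ) :=
    tendsto_of_mem_closure_span (L := fun i => (innerSL ℂ (e s)).comp (b i))
      (L₀ := (innerSL ℂ (e s)).comp b₀) (C := ‖innerSL ℂ (e s)‖ * C)
      (fun i => (ContinuousLinearMap.opNorm_comp_le _ _).trans (by gcongr; exact hb i))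
      (by rintro _ ⟨t, rfl⟩; exact h s t) (htotal ξ)
  have hconj : Tendsto (fun i => ⟪b i ξ, η⟫_ℂ) l (𝓝 ⟪b₀ ξ, η⟫_ℂ) :=
    tendsto_of_mem_closure_span (L := fun i => innerSL ℂ (b i ξ)) (L₀ := innerSL ℂ (b₀ ξ))
      (C := C * ‖ξ‖) (fun i => (innerSL_apply_norm ..).trans_le ((b i).le_of_opNorm_le (hb i) ξ))
      (by
        rintro _ ⟨s, rfl⟩
        simpa [Function.comp_def] using (Complex.continuous_conj.tendsto _).comp (hbasis s))
      (htotal η)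
  simpa [Function.comp_def] using (Complex.continuous_conj.tendsto _).comp hconj

theorem tendsto_predual_of_tendsto_inner_basis {H X : Type*} [NormedAddCommGroup H]
    [InnerProductSpace ℂ H] [CompleteSpace H] (e : HilbertBasis X ℂ H) {M : VonNeumannAlgebra H}
    {b : ι → M.toStarSubalgebra} {b₀ : M.toStarSubalgebra} {C : ℝ} (hb : ∀ i, ‖b i‖ ≤ C)
    (h : ∀ s t, Tendsto (fun i => ⟪e s, (b i : H →L[ℂ] H) (e t)⟫_ℂ) l
      (𝓝 ⟪e s, (b₀ : H →L[ℂ] H) (e t)⟫_ℂ))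
    {ω : M.toStarSubalgebra →L[ℂ] ℂ} (hω : ω ∈ predual M) :
    Tendsto (fun i => ω (b i)) l (𝓝 (ω b₀)) := by
  obtain ⟨ξ, η, hξ, hη, hω⟩ := hω
  simp only [hω]
  have hbound (i n) : ‖⟪η n, (b i : H →L[ℂ] H) (ξ n)⟫_ℂ‖ ≤ C * (‖ξ n‖ ^ 2 + ‖η n‖ ^ 2) := by
    have hC : 0 ≤ C := (norm_nonneg _).trans (hb i)
    calc _ ≤ ‖η n‖ * ‖(b i : H →L[ℂ] H) (ξ n)‖ := norm_inner_le_norm _ _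
      _ ≤ ‖η n‖ * (C * ‖ξ n‖) := by
        gcongr
        exact ContinuousLinearMap.le_of_opNorm_le _ (hb i) _
      _ = C * (‖ξ n‖ * ‖η n‖) := by ring
      _ ≤ C * (‖ξ n‖ ^ 2 + ‖η n‖ ^ 2) := by
        gcongr
        nlinarith [two_mul_le_add_sq ‖ξ n‖ ‖η n‖, norm_nonneg (ξ n), norm_nonneg (η n)]
  exact tendsto_tsum_of_dominated_convergence ((hξ.add hη).mul_left C)
    (fun n => tendsto_inner_of_tendsto_inner_basis e hb h (ξ n) (η n)) (.of_forall hbound)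

variable {Γ : Type*} [Group Γ] {φ : ι → ell2 Γ} {k : ℝ}

theorem norm_multOp_le {A : StarSubalgebra ℂ (ell2 Γ →L[ℂ] ell2 Γ)} (hA : IsIntermediate A)
    {φ : ell2 Γ} (hk : 0 ≤ k) (hφ : herzSchurNorm φ ≤ ENNReal.ofReal k) :
    ‖multOp hA φ‖ ≤ k :=
  ContinuousLinearMap.opNorm_le_bound _ hk fun a => by
    rw [← ENNReal.ofReal_le_ofReal_iff (by positivity), ENNReal.ofReal_mul hk, ofReal_norm,
      ofReal_norm]
    exact (enorm_multOp_le hA φ a).trans (by gcongr)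

theorem tendsto_multOp_reducedCStar (hk : 0 ≤ k)
    (hφ : ∀ i, herzSchurNorm (φ i) ≤ ENNReal.ofReal k)
    (hlim : Tendsto (fun i => ⇑(φ i)) l (𝓝 1)) (a : reducedCStar Γ) :
    Tendsto (fun i => ‖multOp isIntermediate_reducedCStar (φ i) a - a‖) l (𝓝 0) := by
  refine tendsto_iff_norm_sub_tendsto_zero.1 (tendsto_of_mem_closure_span
    (L₀ := ContinuousLinearMap.id ℂ (reducedCStar Γ))
    (fun i => norm_multOp_le isIntermediate_reducedCStar hk (hφ i)) ?_
    (mem_closure_span_leftReg a))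
  rintro _ ⟨x, rfl⟩
  simp only [multOp_leftReg]
  simpa using (tendsto_pi_nhds.1 hlim x).smul_const
    (⟨leftReg x, isIntermediate_reducedCStar.leftReg_mem x⟩ : reducedCStar Γ)

theorem tendsto_multOp_groupVN (hk : 0 ≤ k)
    (hφ : ∀ i, herzSchurNorm (φ i) ≤ ENNReal.ofReal k)
    (hlim : Tendsto (fun i => ⇑(φ i)) l (𝓝 1)) (a : (groupVN Γ).toStarSubalgebra)
    {ω : (groupVN Γ).toStarSubalgebra →L[ℂ] ℂ} (hω : ω ∈ predual (groupVN Γ)) :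
    Tendsto (fun i => ω (multOp isIntermediate_groupVN (φ i) a - a)) l (𝓝 0) := by
  simp only [map_sub]
  refine tendsto_sub_nhds_zero_iff.2 (tendsto_predual_of_tendsto_inner_basis delta (C := k * ‖a‖)
    (b := fun i => multOp isIntermediate_groupVN (φ i) a)
    (fun i => ContinuousLinearMap.le_of_opNorm_le _
      (norm_multOp_le isIntermediate_groupVN hk (hφ i)) a)
    (fun z y => ?_) hω)
  simp only [inner_multOp_delta]
  simpa using (tendsto_pi_nhds.1 hlim (z * y⁻¹)).mul_const
    ⟪delta z, (a : ell2 Γ →L[ℂ] ell2 Γ) (delta y)⟫_ℂ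

end Convergence

section ApproximateUnit

variable {Γ : Type*} [Group Γ]

variable (Γ) in
/-- The finitely supported functions of Herz–Schur norm at most `C`. Each of the three
approximation properties says that, for `C = k`, this set has `1` in its pointwise closure. -/
def finiteMultiplierBall (C : ℝ≥0∞) : Set (Γ → ℂ) :=
  {u | u.support.Finite ∧ herzSchurNorm u ≤ C}

theorem tendsto_zero_of_tendsto_fourierNorm {ι : Type*} {l : Filter ι} {u : ι → Γ → ℂ}
    (h : Tendsto (fun i => fourierNorm (u i)) l (𝓝 0)) : Tendsto u l (𝓝 0) :=
  tendsto_pi_nhds.2 fun x => tendsto_zero_iff_enorm_tendsto_zero.2 <|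
    tendsto_of_tendsto_of_tendsto_of_le_of_le tendsto_const_nhds h (fun _ => zero_le)
      fun i => enorm_apply_le_fourierNorm (u i) x

theorem mem_closure_finiteMultiplierBall {φ : Γ → ℂ} {k : ℝ} (hk : 0 < k)
    (hφ : φ ∈ fourierAlgebra Γ) (hnorm : herzSchurNorm φ ≤ ENNReal.ofReal k) :
    φ ∈ closure (finiteMultiplierBall Γ (ENNReal.ofReal k)) := by
  let ε (n : ℕ) : ℝ := 1 / (n + 1)
  have hε (n : ℕ) : 0 < ε n := Nat.one_div_pos_of_nat
  have hε_lim : Tendsto ε atTop (𝓝 0) := tendsto_one_div_add_atTop_nhds_zero_nat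
  choose v hfin hv using fun n => exists_finite_support_fourierNorm_sub_le hφ
    (ENNReal.ofReal_pos.2 (hε n)).ne'
  have hv_norm (n : ℕ) : herzSchurNorm (v n) ≤ ENNReal.ofReal (k + ε n) := by
    rw [ENNReal.ofReal_add hk.le (hε n).le, ← sub_sub_cancel φ (v n)]
    exact (herzSchurNorm_sub_le _ _).trans
      (add_le_add hnorm ((herzSchurNorm_le_fourierNorm _).trans (hv n)))
  have hv_lim : Tendsto v atTop (𝓝 φ) := by
    have hv_norm_lim : Tendsto (fun n => fourierNorm (φ - v n)) atTop (𝓝 0) :=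
      tendsto_of_tendsto_of_tendsto_of_le_of_le tendsto_const_nhds
        (ENNReal.ofReal_zero ▸ ENNReal.tendsto_ofReal hε_lim) (fun _ => zero_le) hv
    simpa using (tendsto_const_nhds (x := φ)).sub (tendsto_zero_of_tendsto_fourierNorm hv_norm_lim)
  let c (n : ℕ) : ℝ := k / (k + ε n)
  have hc_lim : Tendsto (fun n => (c n : ℂ)) atTop (𝓝 1) := by
    have hlim := (tendsto_const_nhds (x := k)).div (hε_lim.const_add k) (by simpa using hk.ne')
    rw [add_zero, div_self hk.ne'] at hlim
    exact_mod_cast (Complex.continuous_ofReal.tendsto 1).comp hlim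
  refine mem_closure_of_tendsto (one_smul ℂ φ ▸ hc_lim.smul hv_lim) (.of_forall fun n =>
    ⟨(hfin n).subset (Function.support_const_smul_subset _ _), ?_⟩)
  calc herzSchurNorm ((c n : ℂ) • v n)
      ≤ ENNReal.ofReal (c n) * ENNReal.ofReal (k + ε n) := by
        refine (herzSchurNorm_smul_le _ _).trans (mul_le_mul' ?_ (hv_norm n))
        rw [← ofReal_norm, Complex.norm_of_nonneg (div_pos hk (add_pos hk (hε n))).le]
    _ = ENNReal.ofReal k := by
        rw [← ENNReal.ofReal_mul (div_pos hk (add_pos hk (hε n))).le,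
          div_mul_cancel₀ _ (add_pos hk (hε n)).ne']

theorem tendsto_one_of_approximateUnit {ι : Type*} {l : Filter ι} {φ : ι → Γ → ℂ}
    (hunit : ∀ ψ ∈ fourierAlgebra Γ, Tendsto (fun i => fourierNorm (φ i * ψ - ψ)) l (𝓝 0)) :
    Tendsto φ l (𝓝 1) := by
  refine tendsto_pi_nhds.2 fun x => ?_
  have hx := tendsto_pi_nhds.1 (tendsto_zero_of_tendsto_fourierNorm
    (hunit (coeff (delta 1) (delta x)) ⟨_, _, rfl⟩)) x
  simpa [coeff_delta, delta_apply] using hx.add_const 1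

theorem one_mem_closure_of_approximateUnit {ι : Type*} {l : Filter ι} [l.NeBot] {φ : ι → Γ → ℂ}
    {k : ℝ} (hk : 0 < k) (hφ : ∀ i, φ i ∈ fourierAlgebra Γ)
    (hunit : ∀ ψ ∈ fourierAlgebra Γ, Tendsto (fun i => fourierNorm (φ i * ψ - ψ)) l (𝓝 0))
    (hnorm : ∀ i, multiplierCBNorm (φ i) ≤ ENNReal.ofReal k) :
    1 ∈ closure (finiteMultiplierBall Γ (ENNReal.ofReal k)) :=
  isClosed_closure.mem_of_tendsto (tendsto_one_of_approximateUnit hunit) (.of_forall fun i =>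
    mem_closure_finiteMultiplierBall hk (hφ i)
      ((herzSchurNorm_le_multiplierCBNorm _).trans (hnorm i)))

theorem tendsto_fourierNorm_mul_sub {ι : Type*} {l : Filter ι} {φ : ι → Γ → ℂ} {C : ℝ≥0∞}
    (hC : C ≠ ∞) (hφ : ∀ i, herzSchurNorm (φ i) ≤ C) (hlim : Tendsto φ l (𝓝 1)) {ψ : Γ → ℂ}
    (hψ : ψ ∈ fourierAlgebra Γ) : Tendsto (fun i => fourierNorm (φ i * ψ - ψ)) l (𝓝 0) := by
  refine ENNReal.tendsto_nhds_zero.2 fun ε hε => ?_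
  have hC_top : C + 1 ≠ ∞ := by simpa using hC
  obtain ⟨v, hfin, hv⟩ := exists_finite_support_fourierNorm_sub_le hψ (ε := ε / 2 / (C + 1))
    (by simp [ENNReal.div_eq_zero_iff, hε.ne', hC])
  have hsum : Tendsto (fun i => ∑ x ∈ hfin.toFinset, ‖((φ i - 1) * v) x‖ₑ) l (𝓝 0) := by
    rw [← Finset.sum_const_zero (s := hfin.toFinset)]
    refine tendsto_finsetSum _ fun x _ => ?_
    have hx : Tendsto (fun i => ((φ i - 1) * v) x) l (𝓝 0) := by
      simpa using ((tendsto_pi_nhds.1 hlim x).sub_const 1).mul_const (v x)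
    exact tendsto_zero_iff_enorm_tendsto_zero.1 hx
  filter_upwards [hsum.eventually_le_const (ENNReal.half_pos hε.ne')] with i hi
  have hφ_sub : herzSchurNorm (φ i - 1) ≤ C + 1 :=
    (herzSchurNorm_sub_le _ _).trans (add_le_add (hφ i) herzSchurNorm_one_le)
  calc fourierNorm (φ i * ψ - ψ)
      = fourierNorm ((φ i - 1) * (ψ - v) + (φ i - 1) * v) := by ring_nf
    _ ≤ fourierNorm ((φ i - 1) * (ψ - v)) + fourierNorm ((φ i - 1) * v) := fourierNorm_add_le _ _
    _ ≤ (C + 1) * (ε / 2 / (C + 1)) + ε / 2 := by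
      gcongr
      · exact (fourierNorm_mul_le _ _).trans (mul_le_mul' hφ_sub hv)
      · exact (fourierNorm_le_sum fun x hx => by simp_all).trans hi
    _ = ε := by rw [ENNReal.mul_div_cancel (by simp) hC_top, ENNReal.add_halves]

end ApproximateUnit

section Symbol

variable {Γ : Type*} [Group Γ] {A : StarSubalgebra ℂ (ell2 Γ →L[ℂ] ell2 Γ)}
  (hA : IsIntermediate A)

theorem exists_eq_sum_of_finiteDimensional_range {E G : Type*} [NormedAddCommGroup E]
    [NormedSpace ℂ E] [NormedAddCommGroup G] [NormedSpace ℂ G] (T : E →L[ℂ] G)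
    [FiniteDimensional ℂ (LinearMap.range (T : E →ₗ[ℂ] G))] :
    ∃ (n : ℕ) (ω : Fin n → E →L[ℂ] ℂ) (b : Fin n → G), ∀ v, T v = ∑ i, ω i v • b i := by
  let B := Module.finBasis ℂ (LinearMap.range (T : E →ₗ[ℂ] G))
  let T' : E →L[ℂ] LinearMap.range (T : E →ₗ[ℂ] G) := T.codRestrict _ fun v => ⟨v, rfl⟩
  refine ⟨_, fun i => (LinearMap.toContinuousLinearMap (B.coord i)).comp T', fun i => B i,
    fun v => ?_⟩
  have hv := congrArg Subtype.val (B.sum_repr (T' v))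
  rw [Submodule.coe_sum] at hv
  exact hv.symm

theorem memℓp_symbol {T : A →L[ℂ] A} (hT : IsFiniteRank T) : Memℓp (symbol hA T) 2 := by
  have : FiniteDimensional ℂ (LinearMap.range (T : A →ₗ[ℂ] A)) := hT
  obtain ⟨n, ω, b, hsum⟩ := exists_eq_sum_of_finiteDimensional_range T
  let f (i : Fin n) : ell2 Γ := (b i : ell2 Γ →L[ℂ] ell2 Γ) (delta 1)
  let c (i : Fin n) (x : Γ) : ℂ := ω i ⟨leftReg x, hA.leftReg_mem x⟩
  have hc (i : Fin n) (x : Γ) : ‖c i x‖ ≤ ‖ω i‖ :=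
    ((ω i).le_opNorm _).trans (mul_le_of_le_one_right (norm_nonneg _) (norm_leftReg_le x))
  have hsymbol : symbol hA T = fun x => ∑ i, (c i * ⇑(f i)) x := by
    ext x
    have hentry : symbol hA T x = (∑ i, c i x • f i : ell2 Γ) x := by simp [symbol, hsum, c, f]
    rw [hentry, lp.coeFn_sum, Finset.sum_apply]
    rfl
  rw [hsymbol]
  exact Memℓp.finsetSum _ fun i _ => memℓp_mul_of_bounded (hc i) (lp.memℓp (f i))

theorem symbol_mem_fourierAlgebra {T : A →L[ℂ] A} (hT : IsFiniteRank T) :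
    symbol hA T ∈ fourierAlgebra Γ :=
  mem_fourierAlgebra_of_memℓp (memℓp_symbol hA hT)

theorem multiplierCBNorm_symbol_le {T : A →L[ℂ] A} (hT : IsFiniteRank T) :
    multiplierCBNorm (symbol hA T) ≤ cbNorm T :=
  (multiplierCBNorm_le ⟨_, memℓp_symbol hA hT⟩).trans (herzSchurNorm_symbol_le hA T)

/-- The functional `a ↦ ⟨a δ₁, δₓ⟩` on `A`, which reads off the symbol of an operator on `A`. -/
def entryFunctional (A : StarSubalgebra ℂ (ell2 Γ →L[ℂ] ell2 Γ)) (x : Γ) : A →L[ℂ] ℂ :=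
  (innerSL ℂ (delta x)).comp ((ContinuousLinearMap.apply ℂ (ell2 Γ) (delta 1)).comp
    (Subalgebra.toSubmodule A.toSubalgebra).subtypeL)

theorem entryFunctional_apply (x : Γ) (a : A) :
    entryFunctional A x a = (a : ell2 Γ →L[ℂ] ell2 Γ) (delta 1) x :=
  inner_delta_left x _

theorem entryFunctional_mem_predual (x : Γ) :
    entryFunctional (groupVN Γ).toStarSubalgebra x ∈ predual (groupVN Γ) :=
  mem_predual_of_inner (delta 1) (delta x) fun _ => rfl

theorem tendsto_symbol_of_tendsto_entryFunctional {ι : Type*} {l : Filter ι} {T : ι → A →L[ℂ] A}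
    (h : ∀ x, Tendsto (fun i => entryFunctional A x
      (T i ⟨leftReg x, hA.leftReg_mem x⟩ - ⟨leftReg x, hA.leftReg_mem x⟩)) l (𝓝 0)) :
    Tendsto (fun i => symbol hA (T i)) l (𝓝 1) := by
  refine tendsto_pi_nhds.2 fun x => tendsto_sub_nhds_zero_iff.1 ((h x).congr fun i => ?_)
  simp [entryFunctional_apply, symbol, leftReg_delta, delta_apply]

theorem approximateUnit_of_tendsto_symbol {ι : Type*} {l : Filter ι} {T : ι → A →L[ℂ] A} {k : ℝ}
    (hrank : ∀ i, IsFiniteRank (T i)) (hnorm : ∀ i, cbNorm (T i) ≤ ENNReal.ofReal k)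
    (hlim : Tendsto (fun i => symbol hA (T i)) l (𝓝 1)) :
    (∀ i, symbol hA (T i) ∈ fourierAlgebra Γ) ∧
      (∀ ψ ∈ fourierAlgebra Γ,
        Tendsto (fun i => fourierNorm (symbol hA (T i) * ψ - ψ)) l (𝓝 0)) ∧
      ∀ i, multiplierCBNorm (symbol hA (T i)) ≤ ENNReal.ofReal k :=
  ⟨fun i => symbol_mem_fourierAlgebra hA (hrank i),
    fun _ hψ => tendsto_fourierNorm_mul_sub ENNReal.ofReal_ne_top
      (fun i => (herzSchurNorm_symbol_le hA (T i)).trans (hnorm i)) hlim hψ,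
    fun i => (multiplierCBNorm_symbol_le hA (hrank i)).trans (hnorm i)⟩

end Symbol

theorem exists_net_of_mem_closure {X : Type u} [TopologicalSpace X] {s : Set X} {x : X}
    (hx : x ∈ closure s) :
    ∃ (ι : Type u) (_ : Preorder ι) (_ : IsDirectedOrder ι) (_ : Nonempty ι) (v : ι → X),
      (∀ i, v i ∈ s) ∧ Tendsto v atTop (𝓝 x) := by
  choose v hv using fun U : {U // U ∈ 𝓝 x}ᵒᵈ => mem_closure_iff_nhds.1 hx U.ofDual.1 U.ofDual.2
  refine ⟨_, inferInstance, ⟨fun U V => ?_⟩, ⟨.toDual ⟨_, univ_mem⟩⟩, v, fun U => (hv U).2, ?_⟩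
  · exact ⟨.toDual ⟨_, inter_mem U.ofDual.2 V.ofDual.2⟩, Set.inter_subset_left,
      Set.inter_subset_right⟩
  · exact fun U hU => (eventually_ge_atTop (OrderDual.toDual (⟨U, hU⟩ : {U // U ∈ 𝓝 x}))).mono
      fun V (hV : V.ofDual.1 ⊆ U) => hV (hv V).1

theorem exists_net_of_approximateUnit {Γ : Type u} [Group Γ] {ι : Type*} {l : Filter ι} [l.NeBot]
    {φ : ι → Γ → ℂ} {k : ℝ} (hk : 0 < k) (hφ : ∀ i, φ i ∈ fourierAlgebra Γ)
    (hunit : ∀ ψ ∈ fourierAlgebra Γ, Tendsto (fun i => fourierNorm (φ i * ψ - ψ)) l (𝓝 0))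
    (hnorm : ∀ i, multiplierCBNorm (φ i) ≤ ENNReal.ofReal k) :
    ∃ (κ : Type u) (_ : Preorder κ) (_ : IsDirectedOrder κ) (_ : Nonempty κ) (v : κ → ell2 Γ),
      (∀ i, (⇑(v i)).support.Finite) ∧ (∀ i, herzSchurNorm (v i) ≤ ENNReal.ofReal k) ∧
      Tendsto (fun i => ⇑(v i)) atTop (𝓝 1) := by
  obtain ⟨κ, _, _, _, v, hv, hlim⟩ := exists_net_of_mem_closure
    (one_mem_closure_of_approximateUnit hk hφ hunit hnorm)
  have hmem (i : κ) : Memℓp (v i) 2 := memℓp_two_iff.2 <|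
    summable_of_hasFiniteSupport ((hv i).1.subset fun x hx => by simp_all)
  exact ⟨κ, _, ‹_›, ‹_›, fun i => ⟨v i, hmem i⟩, fun i => (hv i).1, fun i => (hv i).2, hlim⟩

end GroupCBAP

end

open GroupCBAP Filter Topology in
theorem theorem2p6 {Γ : Type u} [Group Γ] (k : ℝ) (hk : 1 ≤ k) :
    List.TFAE [
      -- `A(Γ)` has an approximate unit with `M₀A`-norms at most `k`
      ∃ (ι : Type u) (_ : Preorder ι) (_ : IsDirectedOrder ι) (_ : Nonempty ι) (φ : ι → Γ → ℂ),
        (∀ α, φ α ∈ fourierAlgebra Γ) ∧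
        (∀ ψ ∈ fourierAlgebra Γ, Tendsto (fun α => fourierNorm (φ α * ψ - ψ)) atTop (𝓝 0)) ∧
        ∀ α, multiplierCBNorm (φ α) ≤ ENNReal.ofReal k,
      -- the reduced group C*-algebra
      ∃ (ι : Type u) (_ : Preorder ι) (_ : IsDirectedOrder ι) (_ : Nonempty ι)
        (T : ι → (reducedCStar Γ →L[ℂ] reducedCStar Γ)),
        (∀ α, IsFiniteRank (T α)) ∧
        (∀ α, cbNorm (T α) ≤ ENNReal.ofReal k) ∧
        ∀ x, Tendsto (fun α => ‖T α x - x‖) atTop (𝓝 0),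
      -- the group von Neumann algebra
      ∃ (ι : Type u) (_ : Preorder ι) (_ : IsDirectedOrder ι) (_ : Nonempty ι)
        (T : ι → ((groupVN Γ).toStarSubalgebra →L[ℂ] (groupVN Γ).toStarSubalgebra)),
        (∀ α, IsSigmaWeaklyContinuous (T α)) ∧
        (∀ α, IsFiniteRank (T α)) ∧
        (∀ α, cbNorm (T α) ≤ ENNReal.ofReal k) ∧
        ∀ x, ∀ ω ∈ predual (groupVN Γ), Tendsto (fun α => ω (T α x - x)) atTop (𝓝 0)] := by
  tfae_have 1 → 2 := by
    rintro ⟨_, _, _, _, φ, hφ, hunit, hnorm⟩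
    obtain ⟨ι, _, _, _, v, hfin, hv, hlim⟩ :=
      exists_net_of_approximateUnit (by linarith) hφ hunit hnorm
    exact ⟨ι, _, ‹_›, ‹_›, fun i => multOp isIntermediate_reducedCStar (v i),
      fun i => isFiniteRank_multOp _ (hfin i), fun i => (cbNorm_multOp_le _ (v i)).trans (hv i),
      tendsto_multOp_reducedCStar (by linarith) hv hlim⟩
  tfae_have 1 → 3 := by
    rintro ⟨_, _, _, _, φ, hφ, hunit, hnorm⟩
    obtain ⟨ι, _, _, _, v, hfin, hv, hlim⟩ :=
      exists_net_of_approximateUnit (by linarith) hφ hunit hnorm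
    exact ⟨ι, _, ‹_›, ‹_›, fun i => multOp isIntermediate_groupVN (v i),
      fun i => isSigmaWeaklyContinuous_multOp (hfin i), fun i => isFiniteRank_multOp _ (hfin i),
      fun i => (cbNorm_multOp_le _ (v i)).trans (hv i),
      fun a _ hω => tendsto_multOp_groupVN (by linarith) hv hlim a hω⟩
  tfae_have 2 → 1 := by
    rintro ⟨ι, _, _, _, T, hrank, hnorm, hlim⟩
    exact ⟨ι, _, ‹_›, ‹_›, _, approximateUnit_of_tendsto_symbol isIntermediate_reducedCStar hrank
      hnorm (tendsto_symbol_of_tendsto_entryFunctional _ fun x =>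
        ((entryFunctional _ x).continuous.tendsto' 0 0 (map_zero _)).comp
          (tendsto_zero_iff_norm_tendsto_zero.2 (hlim _)))⟩
  tfae_have 3 → 1 := by
    rintro ⟨ι, _, _, _, T, _, hrank, hnorm, hlim⟩
    exact ⟨ι, _, ‹_›, ‹_›, _, approximateUnit_of_tendsto_symbol isIntermediate_groupVN hrank
      hnorm (tendsto_symbol_of_tendsto_entryFunctional _ fun x =>
        hlim _ _ (entryFunctional_mem_predual x))⟩
  tfae_finish
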